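/- Consider algebras with non-empty universe in the language $\{\wedge,\vee,\otimes,\oplus,\neg\}$. A \emph{bilattice} is such an algebra $\mathbf{B}$ in which $\langle B,\wedge,\vee\rangle$ and $\langle B,\otimes,\oplus\rangle$ are lattices, with orders $\le_t$ and $\le_k$, and in which $\neg$ reverses $\le_t$, preserves $\le_k$ and satisfies $\neg\neg a=a$. It is \emph{distributive} if all twelve distributive laws between two different operations among $\wedge,\vee,\otimes,\oplus$ hold. A \emph{bifilter} of $\mathbf{B}$ is a non-empty $F\subseteq B$ that is a lattice filter for both $\le_t$ and $\le_k$; $\mathcal{FF}(a)$ is the bifilter generated by $a$. For a lattice $\mathbf{L}$, the product bilattice $\mathbf{L}\odot\mathbf{L}$ has universe $L\times L$ and operations $(a_1,a_2)\wedge(b_1,b_2)=(a_1\sqcap b_1,a_2\sqcup b_2)$, $(a_1,a_2)\vee(b_1,b_2)=(a_1\sqcup b_1,a_2\sqcap b_2)$, $(a_1,a_2)\otimes(b_1,b_2)=(a_1\sqcap b_1,a_2\sqcap b_2)$, $(a_1,a_2)\oplus(b_1,b_2)=(a_1\sqcup b_1,a_2\sqcup b_2)$, $\neg(a_1,a_2)=(a_2,a_1)$.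 For a bilattice $\mathbf{A}$, $\mathbf{Reg}(\mathbf{A})=\langle \mathrm{Reg}(\mathbf{A}),\otimes,\oplus\rangle$ is the lattice of the elements $a$ with $\neg a=a$. Let $\mathcal{FOUR}=\mathbf{2}\odot\mathbf{2}$, where $\mathbf{2}=\{0<1\}$, let $\mathsf{Tr}=\{(1,1),(1,0)\}$, and let $\mathcal{LB}$ be the logic of the matrix $\langle\mathcal{FOUR},\mathsf{Tr}\rangle$ on the formulas over countably many variables: $\Gamma\vDash_{\mathcal{LB}}\varphi$ iff every homomorphism $h$ from the formula algebra to $\mathcal{FOUR}$ with $h[\Gamma]\subseteq\mathsf{Tr}$ has $h(\varphi)\in\mathsf{Tr}$. A matrix $\langle\mathbf{A},F\rangle$ (an algebra with a subset $F\subseteq A$) is a \emph{model} of $\mathcal{LB}$ if $\Gamma\vDash_{\mathcal{LB}}\varphi$ implies that every homomorphism $h$ from the formula algebra to $\mathbf{A}$ with $h[\Gamma]\subseteq F$ has $h(\varphi)\in F$. It is \emph{reduced} if the identity is the greatest congruence $\theta$ of $\mathbf{A}$ that is compatible with $F$ (i.e. $a\in F$ and $a\mathrel{\theta}b$ imply $b\in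 F$). $\mathbf{Alg}^*\mathcal{LB}$ is the class of algebras $\mathbf{A}$ such that $\langle\mathbf{A},F\rangle$ is a reduced model of $\mathcal{LB}$ for some $F\subseteq A$. \textbf{Theorem.} (1) Let $\mathbf{A}$ be an algebra with at least two elements and let $F\subseteq A$. The following are equivalent: (i) $\langle\mathbf{A},F\rangle$ is a reduced model of $\mathcal{LB}$; (ii) $\mathbf{A}$ is a distributive bilattice and $F$ is a bifilter such that, for all $a,b\in A$ with $a<_t b$, there is $c\in A$ such that either $a\vee c\notin F$ and $b\vee c\in F$, or $\neg a\vee c\in F$ and $\neg b\vee c\notin F$; (iii) $\mathbf{A}$ is a distributive bilattice and $F$ is a bifilter such that, for all $a,b\in A$ with $a<_k b$, there is $c\in A$ such that either $a\vee c\notin F$ and $b\vee c\in F$, or $\neg a\vee c\notin F$ and $\neg b\vee c\in F$; (iv) $\mathbf{A}$ is a distributive bilattice isomorphic to $\mathbf{Reg}(\mathbf{A})\odot\mathbf{Reg}(\mathbf{A})$; moreover $\mathbf{Reg}(\mathbf{A})$ is a distributive lattice with a top element $\top$ such that, for all $a,b\in\mathrm{Reg}(\mathbf{A})$ with $a<_k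 b$, there is $c\in\mathrm{Reg}(\mathbf{A})$ with $a\oplus c\neq\top$ and $b\oplus c=\top$ (that is, $\mathbf{Reg}(\mathbf{A})$ is dual disjunctive); and $F=\mathcal{FF}(\top)$. (2) $\mathbf{Alg}^*\mathcal{LB}$ is closed under direct products of arbitrary families, but it is not closed under subalgebras, and it is not a quasivariety (i.e. it is not the class of all algebras satisfying some set of quasi-identities). -/

import Mathlib

universe u v

/-! Algebras in the language of bilattices, without any axioms. -/

/-- An algebra in the similarity type `{∧, ∨, ⊗, ⊕, ¬}`. -/
class BilatAlgebra (A : Type u) where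
  tmeet : A → A → A
  tjoin : A → A → A
  kmeet : A → A → A
  kjoin : A → A → A
  neg : A → A

infixl:70 " ⋏ " => BilatAlgebra.tmeet
infixl:65 " ⋎ " => BilatAlgebra.tjoin
infixl:70 " ⊗ₖ " => BilatAlgebra.kmeet
infixl:65 " ⊕ₖ " => BilatAlgebra.kjoin
prefix:75 "∼" => BilatAlgebra.neg

/-- Homomorphisms of algebras in the bilattice language. -/
structure IsHom {A : Type u} {B : Type v} [BilatAlgebra A] [BilatAlgebra B] (f : A → B) :
    Prop where
  map_tmeet : ∀ a b, f (a ⋏ b) = f a ⋏ f b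
  map_tjoin : ∀ a b, f (a ⋎ b) = f a ⋎ f b
  map_kmeet : ∀ a b, f (a ⊗ₖ b) = f a ⊗ₖ f b
  map_kjoin : ∀ a b, f (a ⊕ₖ b) = f a ⊕ₖ f b
  map_neg : ∀ a, f (∼a) = ∼(f a)

/-- Isomorphism of algebras. -/
def Isomorphic (A : Type u) (B : Type v) [BilatAlgebra A] [BilatAlgebra B] : Prop :=
  ∃ f : A → B, IsHom f ∧ Function.Bijective f

/-- Direct products. -/
instance instBilatAlgebraPi {ι : Type v} (B : ι → Type u) [∀ i, BilatAlgebra (B i)] :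
    BilatAlgebra (∀ i, B i) where
  tmeet x y := fun i => x i ⋏ y i
  tjoin x y := fun i => x i ⋎ y i
  kmeet x y := fun i => x i ⊗ₖ y i
  kjoin x y := fun i => x i ⊕ₖ y i
  neg x := fun i => ∼(x i)

/-- Subalgebras, given by a non-empty universe closed under the operations. -/
structure BilatSubalgebra (A : Type u) [BilatAlgebra A] where
  carrier : Set A
  nonempty : carrier.Nonempty
  tmeet_mem : ∀ a ∈ carrier, ∀ b ∈ carrier, a ⋏ b ∈ carrier
  tjoin_mem : ∀ a ∈ carrier, ∀ b ∈ carrier, a ⋎ b ∈ carrier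
  kmeet_mem : ∀ a ∈ carrier, ∀ b ∈ carrier, a ⊗ₖ b ∈ carrier
  kjoin_mem : ∀ a ∈ carrier, ∀ b ∈ carrier, a ⊕ₖ b ∈ carrier
  neg_mem : ∀ a ∈ carrier, ∼a ∈ carrier

/-- The algebra structure of a subalgebra. -/
instance instBilatAlgebraSubalgebra {A : Type u} [BilatAlgebra A] (S : BilatSubalgebra A) :
    BilatAlgebra S.carrier where
  tmeet x y := ⟨x.1 ⋏ y.1, S.tmeet_mem _ x.2 _ y.2⟩
  tjoin x y := ⟨x.1 ⋎ y.1, S.tjoin_mem _ x.2 _ y.2⟩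
  kmeet x y := ⟨x.1 ⊗ₖ y.1, S.kmeet_mem _ x.2 _ y.2⟩
  kjoin x y := ⟨x.1 ⊕ₖ y.1, S.kjoin_mem _ x.2 _ y.2⟩
  neg x := ⟨∼x.1, S.neg_mem _ x.2⟩

/-! Bilattices. -/

/-- The truth order. -/
def LeT {A : Type u} [BilatAlgebra A] (a b : A) : Prop := a ⋏ b = a

/-- The knowledge order. -/
def LeK {A : Type u} [BilatAlgebra A] (a b : A) : Prop := a ⊗ₖ b = a

/-- The strict truth order. -/
def LtT {A : Type u} [BilatAlgebra A] (a b : A) : Prop := LeT a b ∧ a ≠ b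

/-- The strict knowledge order. -/
def LtK {A : Type u} [BilatAlgebra A] (a b : A) : Prop := LeK a b ∧ a ≠ b

/-- Two operations form a lattice. -/
structure IsLatticePair {A : Type u} (m j : A → A → A) : Prop where
  meet_comm : ∀ a b, m a b = m b a
  meet_assoc : ∀ a b c, m (m a b) c = m a (m b c)
  join_comm : ∀ a b, j a b = j b a
  join_assoc : ∀ a b c, j (j a b) c = j a (j b c)
  meet_join_self : ∀ a b, m a (j a b) = a
  join_meet_self : ∀ a b, j a (m a b) = a

/-- Bilattices (with negation; no bounds and no interlacing are required). -/
class IsBilattice (A : Type u) [BilatAlgebra A] : Prop where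
  truth_lattice : IsLatticePair (BilatAlgebra.tmeet (A := A)) BilatAlgebra.tjoin
  knowledge_lattice : IsLatticePair (BilatAlgebra.kmeet (A := A)) BilatAlgebra.kjoin
  neg_antitone_truth : ∀ a b : A, LeT a b → LeT (∼b) (∼a)
  neg_monotone_knowledge : ∀ a b : A, LeK a b → LeK (∼a) (∼b)
  neg_neg : ∀ a : A, ∼(∼a) = a

/-- Distributive bilattices: all twelve distributive laws hold. -/
class IsDistributiveBilattice (A : Type u) [BilatAlgebra A] : Prop extends IsBilattice A where
  tmeet_tjoin : ∀ x y z : A, x ⋏ (y ⋎ z) = (x ⋏ y) ⋎ (x ⋏ z)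
  tmeet_kmeet : ∀ x y z : A, x ⋏ (y ⊗ₖ z) = (x ⋏ y) ⊗ₖ (x ⋏ z)
  tmeet_kjoin : ∀ x y z : A, x ⋏ (y ⊕ₖ z) = (x ⋏ y) ⊕ₖ (x ⋏ z)
  tjoin_tmeet : ∀ x y z : A, x ⋎ (y ⋏ z) = (x ⋎ y) ⋏ (x ⋎ z)
  tjoin_kmeet : ∀ x y z : A, x ⋎ (y ⊗ₖ z) = (x ⋎ y) ⊗ₖ (x ⋎ z)
  tjoin_kjoin : ∀ x y z : A, x ⋎ (y ⊕ₖ z) = (x ⋎ y) ⊕ₖ (x ⋎ z)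
  kmeet_tmeet : ∀ x y z : A, x ⊗ₖ (y ⋏ z) = (x ⊗ₖ y) ⋏ (x ⊗ₖ z)
  kmeet_tjoin : ∀ x y z : A, x ⊗ₖ (y ⋎ z) = (x ⊗ₖ y) ⋎ (x ⊗ₖ z)
  kmeet_kjoin : ∀ x y z : A, x ⊗ₖ (y ⊕ₖ z) = (x ⊗ₖ y) ⊕ₖ (x ⊗ₖ z)
  kjoin_tmeet : ∀ x y z : A, x ⊕ₖ (y ⋏ z) = (x ⊕ₖ y) ⋏ (x ⊕ₖ z)
  kjoin_tjoin : ∀ x y z : A, x ⊕ₖ (y ⋎ z) = (x ⊕ₖ y) ⋎ (x ⊕ₖ z)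
  kjoin_kmeet : ∀ x y z : A, x ⊕ₖ (y ⊗ₖ z) = (x ⊕ₖ y) ⊗ₖ (x ⊕ₖ z)

/-- A bifilter: a non-empty set that is a lattice filter for both lattice orders. -/
structure IsBifilter {A : Type u} [BilatAlgebra A] (F : Set A) : Prop where
  nonempty : F.Nonempty
  tmeet_mem : ∀ a ∈ F, ∀ b ∈ F, a ⋏ b ∈ F
  kmeet_mem : ∀ a ∈ F, ∀ b ∈ F, a ⊗ₖ b ∈ F
  mem_of_leT : ∀ a ∈ F, ∀ b, LeT a b → b ∈ F
  mem_of_leK : ∀ a ∈ F, ∀ b, LeK a b → b ∈ F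

/-- The bifilter generated by a set. -/
def bifilterGen {A : Type u} [BilatAlgebra A] (X : Set A) : Set A :=
  ⋂₀ {F : Set A | IsBifilter F ∧ X ⊆ F}

/-! The lattice of regular elements. -/

/-- The regular elements: the fixed points of negation. -/
abbrev Reg (A : Type u) [BilatAlgebra A] : Type u := {a : A // ∼a = a}

/-- Negation commutes with the knowledge meet. -/
theorem neg_kmeet_of_isBilattice {A : Type u} [BilatAlgebra A] [h : IsBilattice A] (a b : A) :
    ∼(a ⊗ₖ b) = ∼a ⊗ₖ ∼b := by
  have K := h.knowledge_lattice
  have idem : ∀ x : A, x ⊗ₖ x = x := fun x => by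
    have := K.meet_join_self x (x ⊗ₖ x)
    rwa [K.join_meet_self] at this
  have lel : ∀ x y : A, LeK (x ⊗ₖ y) x := fun x y => by
    unfold LeK
    rw [K.meet_comm, ← K.meet_assoc, idem]
  have ler : ∀ x y : A, LeK (x ⊗ₖ y) y := fun x y => by
    unfold LeK
    rw [K.meet_assoc, idem]
  have lem : ∀ x y z : A, LeK z x → LeK z y → LeK z (x ⊗ₖ y) := fun x y z hx hy => by
    unfold LeK at *
    rw [← K.meet_assoc, hx, hy]
  have anti : ∀ x y : A, LeK x y → LeK y x → x = y := fun x y hx hy => by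
    unfold LeK at *
    rw [← hx, K.meet_comm, hy]
  refine anti _ _ (lem _ _ _ (h.neg_monotone_knowledge _ _ (lel a b))
    (h.neg_monotone_knowledge _ _ (ler a b))) ?_
  have h1 := h.neg_monotone_knowledge _ _ (lel (∼a) (∼b))
  have h2 := h.neg_monotone_knowledge _ _ (ler (∼a) (∼b))
  rw [h.neg_neg] at h1 h2
  have h3 := h.neg_monotone_knowledge _ _ (lem _ _ _ h1 h2)
  rwa [h.neg_neg] at h3

/-- Negation commutes with the knowledge join. -/
theorem neg_kjoin_of_isBilattice {A : Type u} [BilatAlgebra A] [h : IsBilattice A] (a b : A) :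
    ∼(a ⊕ₖ b) = ∼a ⊕ₖ ∼b := by
  have K := h.knowledge_lattice
  have lel : ∀ x y : A, LeK x (x ⊕ₖ y) := fun x y => K.meet_join_self x y
  have ler : ∀ x y : A, LeK y (x ⊕ₖ y) := fun x y => by
    rw [K.join_comm]; exact K.meet_join_self y x
  have join_eq : ∀ x y : A, LeK x y → x ⊕ₖ y = y := fun x y hx => by
    unfold LeK at hx
    rw [← hx, K.meet_comm, K.join_comm, K.join_meet_self]
  have lej : ∀ x y z : A, LeK x z → LeK y z → LeK (x ⊕ₖ y) z := fun x y z hx hy => by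
    have : (x ⊕ₖ y) ⊕ₖ z = z := by rw [K.join_assoc, join_eq y z hy, join_eq x z hx]
    have h2 := K.meet_join_self (x ⊕ₖ y) z
    rwa [this] at h2
  have anti : ∀ x y : A, LeK x y → LeK y x → x = y := fun x y hx hy => by
    unfold LeK at *
    rw [← hx, K.meet_comm, hy]
  refine anti _ _ ?_ (lej _ _ _ (h.neg_monotone_knowledge _ _ (lel a b))
    (h.neg_monotone_knowledge _ _ (ler a b)))
  have h1 := h.neg_monotone_knowledge _ _ (lel (∼a) (∼b))
  have h2 := h.neg_monotone_knowledge _ _ (ler (∼a) (∼b))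
  rw [h.neg_neg] at h1 h2
  have h3 := h.neg_monotone_knowledge _ _ (lej _ _ _ h1 h2)
  rwa [h.neg_neg] at h3

/-- The lattice `⟨Reg(A), ⊗, ⊕⟩`, a sublattice of the knowledge lattice, whose order is the
restriction of the knowledge order. -/
instance instLatticeReg (A : Type u) [BilatAlgebra A] [h : IsBilattice A] : Lattice (Reg A) where
  le x y := LeK x.1 y.1
  inf x y := ⟨x.1 ⊗ₖ y.1, by rw [neg_kmeet_of_isBilattice, x.2, y.2]⟩
  sup x y := ⟨x.1 ⊕ₖ y.1, by rw [neg_kjoin_of_isBilattice, x.2, y.2]⟩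
  le_refl x := by
    have K := h.knowledge_lattice
    have := K.meet_join_self x.1 (x.1 ⊗ₖ x.1)
    rwa [K.join_meet_self] at this
  le_trans x y z hx hy := by
    have K := h.knowledge_lattice
    unfold LeK at *
    rw [← hx, K.meet_assoc, hy]
  le_antisymm x y hx hy := by
    have K := h.knowledge_lattice
    unfold LeK at *
    exact Subtype.ext (by rw [← hx, K.meet_comm, hy])
  inf_le_left x y := by
    have K := h.knowledge_lattice
    have := K.meet_join_self x.1 (x.1 ⊗ₖ x.1)
    rw [K.join_meet_self] at this
    unfold LeK
    rw [K.meet_comm, ← K.meet_assoc, this]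
  inf_le_right x y := by
    have K := h.knowledge_lattice
    have := K.meet_join_self y.1 (y.1 ⊗ₖ y.1)
    rw [K.join_meet_self] at this
    unfold LeK
    rw [K.meet_assoc, this]
  le_inf x y z hx hy := by
    have K := h.knowledge_lattice
    unfold LeK at *
    rw [← K.meet_assoc, hx, hy]
  le_sup_left x y := h.knowledge_lattice.meet_join_self x.1 y.1
  le_sup_right x y := by
    have K := h.knowledge_lattice
    show LeK y.1 (x.1 ⊕ₖ y.1)
    rw [K.join_comm]
    exact K.meet_join_self y.1 x.1
  sup_le x y z hx hy := by
    have K := h.knowledge_lattice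
    have join_eq : ∀ x y : A, LeK x y → x ⊕ₖ y = y := fun x y hx => by
      unfold LeK at hx
      rw [← hx, K.meet_comm, K.join_comm, K.join_meet_self]
    have e : (x.1 ⊕ₖ y.1) ⊕ₖ z.1 = z.1 := by
      rw [K.join_assoc, join_eq _ _ hy, join_eq _ _ hx]
    have h2 := K.meet_join_self (x.1 ⊕ₖ y.1) z.1
    rwa [e] at h2

/-- `L` is a dual disjunctive lattice with top element `t`: a distributive lattice with greatest
element `t` such that `a < b` implies `a ⊔ c ≠ t` and `b ⊔ c = t` for some `c`. -/
structure IsDualDisjunctive (L : Type u) [Lattice L] (t : L) : Prop where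
  distrib : ∀ x y z : L, x ⊓ (y ⊔ z) = (x ⊓ y) ⊔ (x ⊓ z)
  isTop : ∀ x : L, x ≤ t
  disjunctive : ∀ a b : L, a < b → ∃ c : L, a ⊔ c ≠ t ∧ b ⊔ c = t

/-! Product bilattices and the four-element bilattice. -/

/-- The universe `L × L` of the product bilattice `L ⊙ L`. -/
@[ext]
structure ProductBilattice (L : Type u) where
  fst : L
  snd : L

/-- The operations of the product bilattice `L ⊙ L`. -/
instance instBilatAlgebraProductBilattice (L : Type u) [Lattice L] :
    BilatAlgebra (ProductBilattice L) where
  tmeet a b := ⟨a.fst ⊓ b.fst, a.snd ⊔ b.snd⟩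
  tjoin a b := ⟨a.fst ⊔ b.fst, a.snd ⊓ b.snd⟩
  kmeet a b := ⟨a.fst ⊓ b.fst, a.snd ⊓ b.snd⟩
  kjoin a b := ⟨a.fst ⊔ b.fst, a.snd ⊔ b.snd⟩
  neg a := ⟨a.snd, a.fst⟩

/-- The four-element bilattice `FOUR = 2 ⊙ 2`. Its truth order is `f < ⊥, ⊤ < t` and its knowledge
order is `⊥ < f, t < ⊤`, where `t = (1,0)`, `f = (0,1)`, `⊤ = (1,1)`, `⊥ = (0,0)`. -/
abbrev Four : Type := ProductBilattice Bool

/-- The set `Tr = {⊤, t}` of designated elements of `FOUR`. -/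
def Tr : Set Four := {⟨true, true⟩, ⟨true, false⟩}

/-! The logic `LB`, its models, and reduced matrices. -/

/-- Formulas over a countable set of variables, without constants. -/
inductive Fm : Type where
  | var : ℕ → Fm
  | tmeet : Fm → Fm → Fm
  | tjoin : Fm → Fm → Fm
  | kmeet : Fm → Fm → Fm
  | kjoin : Fm → Fm → Fm
  | neg : Fm → Fm

/-- The formula algebra. -/
instance instBilatAlgebraFm : BilatAlgebra Fm where
  tmeet := Fm.tmeet
  tjoin := Fm.tjoin
  kmeet := Fm.kmeet
  kjoin := Fm.kjoin
  neg := Fm.neg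

/-- The consequence relation defined by the matrix `⟨A, D⟩`. -/
def MatrixConsequence {A : Type u} [BilatAlgebra A] (D : Set A) (Γ : Set Fm) (φ : Fm) : Prop :=
  ∀ h : Fm → A, IsHom h → (∀ γ ∈ Γ, h γ ∈ D) → h φ ∈ D

/-- The logic `LB`, defined by the matrix `⟨FOUR, Tr⟩`. -/
def LB (Γ : Set Fm) (φ : Fm) : Prop := MatrixConsequence Tr Γ φ

/-- The matrix `⟨A, F⟩` is a model of `LB`. -/
def IsModelLB {A : Type u} [BilatAlgebra A] (F : Set A) : Prop :=
  ∀ (Γ : Set Fm) (φ : Fm), LB Γ φ → MatrixConsequence F Γ φ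

/-- Congruences of an algebra. -/
structure IsCongruence {A : Type u} [BilatAlgebra A] (θ : A → A → Prop) : Prop where
  equivalence : Equivalence θ
  tmeet : ∀ a a' b b', θ a a' → θ b b' → θ (a ⋏ b) (a' ⋏ b')
  tjoin : ∀ a a' b b', θ a a' → θ b b' → θ (a ⋎ b) (a' ⋎ b')
  kmeet : ∀ a a' b b', θ a a' → θ b b' → θ (a ⊗ₖ b) (a' ⊗ₖ b')
  kjoin : ∀ a a' b b', θ a a' → θ b b' → θ (a ⊕ₖ b) (a' ⊕ₖ b')
  neg : ∀ a a', θ a a' → θ (∼a) (∼a')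

/-- Matrix congruences of `⟨A, F⟩`: the congruences compatible with `F`. -/
def IsMatrixCongruence {A : Type u} [BilatAlgebra A] (F : Set A) (θ : A → A → Prop) : Prop :=
  IsCongruence θ ∧ ∀ a b, a ∈ F → θ a b → b ∈ F

/-- `θ` is the Leibniz congruence of `⟨A, F⟩`: the greatest matrix congruence. -/
def IsLeibnizCongruence {A : Type u} [BilatAlgebra A] (F : Set A) (θ : A → A → Prop) : Prop :=
  IsMatrixCongruence F θ ∧
    ∀ η : A → A → Prop, IsMatrixCongruence F η → ∀ a b, η a b → θ a b

/-- `⟨A, F⟩` is a reduced model of `LB`: a model whose Leibniz congruence is the identity. -/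
def IsReducedModelLB {A : Type u} [BilatAlgebra A] (F : Set A) : Prop :=
  IsModelLB F ∧ IsLeibnizCongruence F (fun a b => a = b)

/-- The class of algebraic reducts of the reduced models of `LB` (algebras are non-empty). -/
def AlgStarLB (A : Type u) [BilatAlgebra A] : Prop :=
  Nonempty A ∧ ∃ F : Set A, IsReducedModelLB F

/-! Quasivarieties. -/

/-- A quasi-identity `p₁ ≈ q₁ & … & pₙ ≈ qₙ → p ≈ q`. -/
structure QuasiIdentity where
  premises : List (Fm × Fm)
  conclusion : Fm × Fm

/-- Validity of a quasi-identity in an algebra. -/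
def QuasiIdentity.Holds (q : QuasiIdentity) (A : Type u) [BilatAlgebra A] : Prop :=
  ∀ h : Fm → A, IsHom h → (∀ e ∈ q.premises, h e.1 = h e.2) →
    h q.conclusion.1 = h q.conclusion.2

/-- A class of algebras is a quasivariety if it consists of all (non-empty) algebras that satisfy
some set of quasi-identities. -/
def IsQuasivariety (K : ∀ (A : Type u) [BilatAlgebra A], Prop) : Prop :=
  ∃ Q : Set QuasiIdentity, ∀ (A : Type u) [BilatAlgebra A],
    K A ↔ (Nonempty A ∧ ∀ q ∈ Q, q.Holds A)

/-! Everything is governed by the homomorphisms to `FOUR`. In a distributive bilattice, a prime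
filter of the truth lattice is closed upwards or closed downwards in the knowledge order
(`upward_or_downward_of_prime`, resting on `LeK.tmeet_leT_tjoin`). In the upward case `P` is a prime
bifilter and `a ↦ (a ∈ P, ¬a ∈ P)` is a homomorphism to `FOUR`; in the downward case the conjugate
`{a | ¬a ∉ P}` plays this role. With the prime filter theorem, these maps separate points, so
identities of `FOUR` hold in every distributive bilattice, and they separate a bifilter from outside
points, so bifilters are models of `LB`.

Conversely, in a model of `LB` the Leibniz congruence is explicit: `a` and `b` are related iff `a ∨
c`, `b ∨ c` and likewise `¬a ∨ c`, `¬b ∨ c` agree on membership in `F` for every `c` (`SameJoins`).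
Hence a reduced model satisfies all identities of `FOUR`, and conditions (ii) and (iii) say that
comparable related elements coincide; passing to meets extends this to all pairs.

For (iv), the term `regPart` sends `(a₁, a₂)` to `(a₁, a₁)`, so `regPart a` and `regPart (¬a)` are
coordinates over the regular elements. Membership in `F` depends only on `regPart a`. In a reduced
model `F` has just one regular member, necessarily the top, and separation in the knowledge order
becomes dual disjunctivity.

For (2), a product of reduced filters is reduced, since contexts can be chosen one coordinate at a
time. The knowledge order of `FOUR` is a subalgebra of its square whose regular elements form a
three-element chain, which is not dual disjunctive; quasivarieties are closed under subalgebras. -/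

/-! Prime filters of distributive lattices. -/

/-- A filter of a distributive lattice is separated from any outside point by a prime filter. -/
theorem exists_prime_filter_of_notMem {L : Type u} [DistribLattice L] {G : Set L}
    (hne : G.Nonempty) (hinf : ∀ x ∈ G, ∀ y ∈ G, x ⊓ y ∈ G)
    (hup : ∀ x ∈ G, ∀ y, x ≤ y → y ∈ G) {a : L} (ha : a ∉ G) :
    ∃ P : Set L, G ⊆ P ∧ a ∉ P ∧ (∀ x y, x ⊓ y ∈ P ↔ x ∈ P ∧ y ∈ P) ∧
      (∀ x y, x ⊔ y ∈ P ↔ x ∈ P ∨ y ∈ P) := by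
  have hG : Order.IsPFilter G := Order.IsPFilter.of_def hne
    (fun x hx y hy => ⟨x ⊓ y, hinf x hx y hy, inf_le_left, inf_le_right⟩)
    (fun {x y} hxy hx => hup x hx y hxy)
  have hdisj : Disjoint (hG.toPFilter : Set L) (Order.Ideal.principal a : Set L) :=
    Set.disjoint_left.2 fun x hx hxa => ha (hup x hx a hxa)
  obtain ⟨J, hJ, hle, hd⟩ := DistribLattice.prime_ideal_of_disjoint_filter_ideal hdisj
  refine ⟨(J : Set L)ᶜ, fun x hx => Set.disjoint_left.1 hd hx,
    fun h => h (hle Order.Ideal.mem_principal_self), fun x y => ?_, fun x y => ?_⟩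
  · simp only [Set.mem_compl_iff, SetLike.mem_coe, ← not_or]
    exact not_congr ⟨fun h => hJ.mem_or_mem h,
      fun h => h.elim (J.lower inf_le_left) (J.lower inf_le_right)⟩
  · simp only [Set.mem_compl_iff, SetLike.mem_coe, ← not_and_or]
    exact not_congr Order.Ideal.sup_mem_iff

theorem Antitone.map_inf_of_involutive {L : Type u} [Lattice L] {f : L → L} (hf : Antitone f)
    (hi : Function.Involutive f) (x y : L) : f (x ⊓ y) = f x ⊔ f y := by
  refine le_antisymm ?_ (sup_le (hf inf_le_left) (hf inf_le_right))
  rw [← hi (f x ⊔ f y)]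
  refine hf (le_inf ?_ ?_)
  · rw [← hi x]; exact hf (by rw [hi x]; exact le_sup_left)
  · rw [← hi y]; exact hf (by rw [hi y]; exact le_sup_right)

/-! Elementary facts about bilattices. -/

/-- The lattice given by a pair of lattice operations. -/
abbrev IsLatticePair.toLattice {A : Type u} {m j : A → A → A} (h : IsLatticePair m j) :
    Lattice A :=
  letI : Max A := ⟨j⟩
  letI : Min A := ⟨m⟩
  Lattice.mk' h.join_comm h.join_assoc h.meet_comm h.meet_assoc h.join_meet_self h.meet_join_self

section Bilattice

variable {A : Type u} [BilatAlgebra A]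

section

variable [h : IsBilattice A]

theorem tmeet_self (a : A) : a ⋏ a = a :=
  letI := h.truth_lattice.toLattice
  inf_idem a

theorem tjoin_self (a : A) : a ⋎ a = a :=
  letI := h.truth_lattice.toLattice
  sup_idem a

theorem kmeet_self (a : A) : a ⊗ₖ a = a :=
  letI := h.knowledge_lattice.toLattice
  inf_idem a

theorem LeK.antisymm {a b : A} (hab : LeK a b) (hba : LeK b a) : a = b := by
  unfold LeK at *
  rw [← hab, h.knowledge_lattice.meet_comm, hba]

theorem kmeet_leK_left (a b : A) : LeK (a ⊗ₖ b) a :=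
  letI := h.knowledge_lattice.toLattice
  inf_eq_left.2 (inf_le_left : a ⊓ b ≤ a)

theorem kmeet_leK_right (a b : A) : LeK (a ⊗ₖ b) b :=
  letI := h.knowledge_lattice.toLattice
  inf_eq_left.2 (inf_le_right : a ⊓ b ≤ b)

theorem leK_kjoin_left (a b : A) : LeK a (a ⊕ₖ b) :=
  h.knowledge_lattice.meet_join_self a b

theorem leK_kjoin_right (a b : A) : LeK b (a ⊕ₖ b) := by
  rw [h.knowledge_lattice.join_comm]
  exact leK_kjoin_left b a

theorem neg_tmeet (a b : A) : ∼(a ⋏ b) = ∼a ⋎ ∼b :=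
  letI := h.truth_lattice.toLattice
  Antitone.map_inf_of_involutive (f := fun x : A => ∼x)
    (fun x y hxy => inf_eq_left.1 (h.neg_antitone_truth x y (inf_eq_left.2 hxy))) h.neg_neg a b

theorem neg_tjoin (a b : A) : ∼(a ⋎ b) = ∼a ⋏ ∼b := by
  rw [← h.neg_neg (∼a ⋏ ∼b), neg_tmeet, h.neg_neg, h.neg_neg]

end

/-! Distributive bilattices and homomorphisms to `FOUR`. -/

section Distributive

variable [h : IsDistributiveBilattice A]

/-- In a distributive bilattice, each operation of one lattice is monotone for the other order. -/
theorem LeK.tmeet_left {a b : A} (hab : LeK a b) (c : A) : LeK (c ⋏ a) (c ⋏ b) := by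
  unfold LeK at *
  rw [← h.tmeet_kmeet, hab]

theorem LeK.tjoin_left {a b : A} (hab : LeK a b) (c : A) : LeK (c ⋎ a) (c ⋎ b) := by
  unfold LeK at *
  rw [← h.tjoin_kmeet, hab]

theorem LeK.tjoin_right {a b : A} (hab : LeK a b) (c : A) : LeK (a ⋎ c) (b ⋎ c) := by
  rw [h.truth_lattice.join_comm a, h.truth_lattice.join_comm b]
  exact hab.tjoin_left c

/-- With the next lemma, this makes primeness for the truth operations carry over to the knowledge
operations. -/
theorem tmeet_leT_kmeet (a b : A) : LeT (a ⋏ b) (a ⊗ₖ b) := by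
  have T := h.truth_lattice
  unfold LeT
  have e1 : a ⋏ b ⋏ a = a ⋏ b := by rw [T.meet_assoc, T.meet_comm b a, ← T.meet_assoc, tmeet_self]
  have e2 : a ⋏ b ⋏ b = a ⋏ b := by rw [T.meet_assoc, tmeet_self]
  rw [h.tmeet_kmeet, e1, e2, kmeet_self]

theorem kjoin_leT_tjoin (a b : A) : LeT (a ⊕ₖ b) (a ⋎ b) := by
  have T := h.truth_lattice
  unfold LeT
  rw [T.meet_comm, h.tmeet_kjoin, T.meet_comm _ a, T.meet_join_self, T.meet_comm _ b,
    T.join_comm a b, T.meet_join_self]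

/-- Both inequalities of `(a ∧ d) ∧ (b ∨ c) = a ∧ d` are proved in the knowledge order: enlarging
`c` to `d` or shrinking `b` to `a` turns the left side into `a ∧ d` by absorption. -/
theorem LeK.tmeet_leT_tjoin {a b c d : A} (hab : LeK a b) (hcd : LeK c d) :
    LeT (a ⋏ d) (b ⋎ c) := by
  have T := h.truth_lattice
  refine LeK.antisymm ?_ ?_
  · have := (hcd.tjoin_left b).tmeet_left (a ⋏ d)
    rwa [T.meet_assoc a d (b ⋎ d), T.join_comm b d, T.meet_join_self] at this
  · have := (hab.tjoin_right c).tmeet_left (a ⋏ d)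
    rwa [T.meet_comm a d, T.meet_assoc d a (a ⋎ c), T.meet_join_self, T.meet_comm d a] at this

end Distributive

/-- Prime bifilters, where the empty set and the whole algebra are allowed. -/
structure IsPrimeBifilter (P : Set A) : Prop where
  tmeet_mem : ∀ x y, x ⋏ y ∈ P ↔ x ∈ P ∧ y ∈ P
  tjoin_mem : ∀ x y, x ⋎ y ∈ P ↔ x ∈ P ∨ y ∈ P
  kmeet_mem : ∀ x y, x ⊗ₖ y ∈ P ↔ x ∈ P ∧ y ∈ P
  kjoin_mem : ∀ x y, x ⊕ₖ y ∈ P ↔ x ∈ P ∨ y ∈ P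

open Classical in
/-- The map to `FOUR` that a set of elements induces. -/
noncomputable def toFour (P : Set A) (a : A) : Four := ⟨decide (a ∈ P), decide (∼a ∈ P)⟩

/-- Second coordinates are governed by the De Morgan laws: negation swaps the truth operations and
fixes the knowledge ones, exactly as in `FOUR`. -/
theorem IsPrimeBifilter.isHom_toFour [h : IsBilattice A] {P : Set A} (hP : IsPrimeBifilter P) :
    IsHom (toFour P) where
  map_tmeet a b := by
    simp only [toFour, BilatAlgebra.tmeet]
    congr 1
    · rw [← Bool.coe_iff_coe]; simpa using hP.tmeet_mem a b
    · rw [← Bool.coe_iff_coe]; simpa [← neg_tmeet] using hP.tjoin_mem (∼a) (∼b)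
  map_tjoin a b := by
    simp only [toFour, BilatAlgebra.tjoin]
    congr 1
    · rw [← Bool.coe_iff_coe]; simpa using hP.tjoin_mem a b
    · rw [← Bool.coe_iff_coe]; simpa [← neg_tjoin] using hP.tmeet_mem (∼a) (∼b)
  map_kmeet a b := by
    simp only [toFour, BilatAlgebra.kmeet]
    congr 1
    · rw [← Bool.coe_iff_coe]; simpa using hP.kmeet_mem a b
    · rw [← Bool.coe_iff_coe]
      simpa [← neg_kmeet_of_isBilattice] using hP.kmeet_mem (∼a) (∼b)
  map_kjoin a b := by
    simp only [toFour, BilatAlgebra.kjoin]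
    congr 1
    · rw [← Bool.coe_iff_coe]; simpa using hP.kjoin_mem a b
    · rw [← Bool.coe_iff_coe]
      simpa [← neg_kjoin_of_isBilattice] using hP.kjoin_mem (∼a) (∼b)
  map_neg a := by
    refine congrArg₂ ProductBilattice.mk rfl ?_
    rw [← Bool.coe_iff_coe]
    simp [h.neg_neg, toFour]

end Bilattice

section Bilattice

variable {A : Type u} [BilatAlgebra A]

theorem IsPrimeBifilter.mem_iff_toFour {P : Set A} (a : A) :
    a ∈ P ↔ (toFour P a).fst = true := by
  simp [toFour]

section

variable [h : IsDistributiveBilattice A]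

/-- A prime truth filter that is closed upwards in the knowledge order is a prime bifilter. -/
theorem isPrimeBifilter_of_upward {P : Set A} (hm : ∀ x y, x ⋏ y ∈ P ↔ x ∈ P ∧ y ∈ P)
    (hj : ∀ x y, x ⋎ y ∈ P ↔ x ∈ P ∨ y ∈ P) (hup : ∀ x y, LeK x y → x ∈ P → y ∈ P) :
    IsPrimeBifilter P where
  tmeet_mem := hm
  tjoin_mem := hj
  kmeet_mem x y := by
    refine ⟨fun hxy => ⟨hup _ _ (kmeet_leK_left x y) hxy, hup _ _ (kmeet_leK_right x y) hxy⟩,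
      fun hxy => ?_⟩
    have := (hm x y).2 hxy
    rw [← show x ⋏ y ⋏ (x ⊗ₖ y) = x ⋏ y from tmeet_leT_kmeet x y] at this
    exact ((hm _ _).1 this).2
  kjoin_mem x y := by
    refine ⟨fun hxy => ?_, fun hxy => hxy.elim (hup _ _ (leK_kjoin_left x y))
      (hup _ _ (leK_kjoin_right x y))⟩
    rw [← show (x ⊕ₖ y) ⋏ (x ⋎ y) = x ⊕ₖ y from kjoin_leT_tjoin x y] at hxy
    exact (hj _ _).1 ((hm _ _).1 hxy).2

/-- The conjugate of a prime truth filter that is closed downwards in the knowledge order is a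
prime bifilter. -/
theorem isPrimeBifilter_of_downward {P : Set A} (hm : ∀ x y, x ⋏ y ∈ P ↔ x ∈ P ∧ y ∈ P)
    (hj : ∀ x y, x ⋎ y ∈ P ↔ x ∈ P ∨ y ∈ P) (hdown : ∀ x y, LeK x y → y ∈ P → x ∈ P) :
    IsPrimeBifilter {a : A | ∼a ∉ P} := by
  refine isPrimeBifilter_of_upward (fun x y => ?_) (fun x y => ?_) (fun x y hxy hx hy => ?_)
  · simp only [Set.mem_ofPred_eq, neg_tmeet, hj, not_or]
  · simp only [Set.mem_ofPred_eq, neg_tjoin, hm, not_and_or]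
  · exact hx (hdown _ _ (h.neg_monotone_knowledge x y hxy) hy)

/-- A prime truth filter is closed upwards or downwards in the knowledge order. -/
theorem upward_or_downward_of_prime {P : Set A} (hm : ∀ x y, x ⋏ y ∈ P ↔ x ∈ P ∧ y ∈ P)
    (hj : ∀ x y, x ⋎ y ∈ P ↔ x ∈ P ∨ y ∈ P) :
    (∀ x y, LeK x y → x ∈ P → y ∈ P) ∨ (∀ x y, LeK x y → y ∈ P → x ∈ P) := by
  by_contra hcon
  push Not at hcon
  obtain ⟨⟨a, b, hab, ha, hb⟩, ⟨c, d, hcd, hd, hc⟩⟩ := hcon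
  have hmem := (hm a d).2 ⟨ha, hd⟩
  rw [← show a ⋏ d ⋏ (b ⋎ c) = a ⋏ d from hab.tmeet_leT_tjoin hcd] at hmem
  exact ((hj b c).1 ((hm _ _).1 hmem).2).elim hb hc

/-- A truth filter is separated from any outside point by a prime truth filter. -/
theorem exists_prime_truth_filter {G : Set A} (hne : G.Nonempty)
    (hmeet : ∀ x ∈ G, ∀ y ∈ G, x ⋏ y ∈ G) (hup : ∀ x ∈ G, ∀ y, LeT x y → y ∈ G) {a : A}
    (ha : a ∉ G) :
    ∃ P : Set A, G ⊆ P ∧ a ∉ P ∧ (∀ x y, x ⋏ y ∈ P ↔ x ∈ P ∧ y ∈ P) ∧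
      (∀ x y, x ⋎ y ∈ P ↔ x ∈ P ∨ y ∈ P) :=
  letI : DistribLattice A :=
    { h.truth_lattice.toLattice with
      le_sup_inf := fun x y z => @le_of_eq A
        h.truth_lattice.toLattice.toPreorder _ _ (h.tjoin_tmeet x y z).symm }
  exists_prime_filter_of_notMem hne hmeet (fun x hx y hxy => hup x hx y (inf_eq_left.2 hxy)) ha

/-- A bifilter is separated from any outside point by a homomorphism to `FOUR`. -/
theorem IsBifilter.exists_isHom_four {F : Set A} (hF : IsBifilter F) {a : A} (ha : a ∉ F) :
    ∃ f : A → Four, IsHom f ∧ (∀ x ∈ F, (f x).fst = true) ∧ (f a).fst ≠ true := by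
  obtain ⟨P, hFP, haP, hm, hj⟩ :=
    exists_prime_truth_filter hF.nonempty hF.tmeet_mem hF.mem_of_leT ha
  have hP : IsPrimeBifilter P := by
    refine isPrimeBifilter_of_upward hm hj ((upward_or_downward_of_prime hm hj).resolve_right ?_)
    -- If `P` were closed downwards, then `a ≤ₖ a ⊕ f ∈ F ⊆ P` would put `a` in `P`.
    intro hdown
    obtain ⟨f, hf⟩ := hF.nonempty
    exact haP (hdown a _ (leK_kjoin_left a f)
      (hFP (hF.mem_of_leK f hf _ (leK_kjoin_right a f))))
  refine ⟨toFour P, hP.isHom_toFour, fun x hx => ?_, fun hfa => ?_⟩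
  · exact (IsPrimeBifilter.mem_iff_toFour x).1 (hFP hx)
  · exact haP ((IsPrimeBifilter.mem_iff_toFour a).2 hfa)

/-- The homomorphisms to `FOUR` separate the points of a distributive bilattice. -/
theorem eq_of_forall_isHom_four {a b : A} (hab : ∀ f : A → Four, IsHom f → f a = f b) :
    a = b := by
  have T := h.truth_lattice
  have key : ∀ x y : A, (∀ f : A → Four, IsHom f → f x = f y) → LeT x y := by
    intro x y hxy
    by_contra hcon
    -- If `x ≤ y` fails, the principal truth filter of `x` misses `y`.
    obtain ⟨P, hGP, hyP, hm, hj⟩ := exists_prime_truth_filter (G := {z | LeT x z}) (a := y)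
      ⟨x, tmeet_self x⟩
      (fun z hz w hw => by
        simp only [Set.mem_ofPred_eq, LeT] at *
        rw [← T.meet_assoc, hz, hw])
      (fun z hz w hw => by
        simp only [Set.mem_ofPred_eq, LeT] at *
        rw [← hz, T.meet_assoc, hw]) hcon
    have hxP : x ∈ P := hGP (tmeet_self x)
    rcases upward_or_downward_of_prime hm hj with hup | hdown
    · have e := hxy _ (isPrimeBifilter_of_upward hm hj hup).isHom_toFour
      rw [IsPrimeBifilter.mem_iff_toFour, e, ← IsPrimeBifilter.mem_iff_toFour] at hxP
      exact hyP hxP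
    -- The conjugate contains `∼z` iff `z ∉ P`, so it is tested on the negations of `x` and `y`.
    · have hP := isPrimeBifilter_of_downward hm hj hdown
      have e := hxy _ hP.isHom_toFour
      have e' : ∼x ∈ {a : A | ∼a ∉ P} ↔ ∼y ∈ {a : A | ∼a ∉ P} := by
        rw [IsPrimeBifilter.mem_iff_toFour, IsPrimeBifilter.mem_iff_toFour,
          hP.isHom_toFour.map_neg, hP.isHom_toFour.map_neg, e]
      simp only [Set.mem_ofPred_eq, h.neg_neg] at e'
      exact e'.2 hyP hxP
  have h1 := key a b hab
  have h2 := key b a fun f hf => (hab f hf).symm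
  unfold LeT at h1 h2
  rw [← h1, T.meet_comm, h2]

end

end Bilattice

/-! Evaluation of formulas, and models of the logic. -/

/-- The value of a formula under an assignment. -/
def Fm.eval {A : Type u} [BilatAlgebra A] (w : ℕ → A) : Fm → A
  | .var n => w n
  | .tmeet p q => p.eval w ⋏ q.eval w
  | .tjoin p q => p.eval w ⋎ q.eval w
  | .kmeet p q => p.eval w ⊗ₖ q.eval w
  | .kjoin p q => p.eval w ⊕ₖ q.eval w
  | .neg p => ∼(p.eval w)

section Eval

variable {A : Type u} [BilatAlgebra A]

theorem Fm.isHom_eval (w : ℕ → A) : IsHom (Fm.eval w) :=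
  ⟨fun _ _ => rfl, fun _ _ => rfl, fun _ _ => rfl, fun _ _ => rfl, fun _ => rfl⟩

theorem IsHom.eq_eval {f : Fm → A} (hf : IsHom f) (p : Fm) :
    f p = p.eval fun n => f (.var n) := by
  induction p with
  | var n => rfl
  | tmeet p q hp hq => exact (hf.map_tmeet p q).trans (by rw [hp, hq]; rfl)
  | tjoin p q hp hq => exact (hf.map_tjoin p q).trans (by rw [hp, hq]; rfl)
  | kmeet p q hp hq => exact (hf.map_kmeet p q).trans (by rw [hp, hq]; rfl)
  | kjoin p q hp hq => exact (hf.map_kjoin p q).trans (by rw [hp, hq]; rfl)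
  | neg p hp => exact (hf.map_neg p).trans (by rw [hp]; rfl)

theorem IsHom.comp {B : Type v} {C : Type*} [BilatAlgebra B] [BilatAlgebra C] {g : B → C}
    {f : A → B} (hg : IsHom g) (hf : IsHom f) : IsHom (g ∘ f) where
  map_tmeet a b := by simp only [Function.comp, hf.map_tmeet, hg.map_tmeet]
  map_tjoin a b := by simp only [Function.comp, hf.map_tjoin, hg.map_tjoin]
  map_kmeet a b := by simp only [Function.comp, hf.map_kmeet, hg.map_kmeet]
  map_kjoin a b := by simp only [Function.comp, hf.map_kjoin, hg.map_kjoin]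
  map_neg a := by simp only [Function.comp, hf.map_neg, hg.map_neg]

theorem mem_Tr {x : Four} : x ∈ Tr ↔ x.fst = true := by
  rcases x with ⟨_ | _, _ | _⟩ <;> simp [Tr]

/-- A bifilter of a distributive bilattice is a model of `LB`. -/
theorem IsBifilter.isModelLB [IsDistributiveBilattice A] {F : Set A} (hF : IsBifilter F) :
    IsModelLB F := by
  intro Γ φ hφ g hg hΓ
  by_contra hcon
  obtain ⟨f, hf, hfF, hfa⟩ := hF.exists_isHom_four hcon
  exact hfa (mem_Tr.1 (hφ (f ∘ g) (hf.comp hg) fun γ hγ => mem_Tr.2 (hfF _ (hΓ γ hγ))))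

/-- A model of `LB` is closed under the rules that are sound in `FOUR`. -/
theorem IsModelLB.mem_of_rule {F : Set A} (hF : IsModelLB F) (Γ : Set Fm) (φ : Fm)
    (hrule : ∀ w : ℕ → Four, (∀ γ ∈ Γ, (γ.eval w).fst = true) → (φ.eval w).fst = true)
    (w : ℕ → A) (hw : ∀ γ ∈ Γ, γ.eval w ∈ F) : φ.eval w ∈ F := by
  refine hF Γ φ (fun g hg hΓ => ?_) _ (Fm.isHom_eval w) hw
  rw [mem_Tr, hg.eq_eval]
  exact hrule _ fun γ hγ => by rw [← hg.eq_eval]; exact mem_Tr.1 (hΓ γ hγ)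

theorem IsModelLB.mem_of_mem {F : Set A} (hF : IsModelLB F) (φ ψ : Fm)
    (hrule : ∀ w : ℕ → Four, (φ.eval w).fst = true → (ψ.eval w).fst = true)
    (w : ℕ → A) (hw : φ.eval w ∈ F) : ψ.eval w ∈ F :=
  hF.mem_of_rule {φ} ψ (fun w' hw' => hrule w' (hw' φ rfl)) w (fun γ hγ => by
    rw [Set.mem_singleton_iff.1 hγ]; exact hw)

theorem IsModelLB.mem_iff_mem {F : Set A} (hF : IsModelLB F) (φ ψ : Fm)
    (hrule : ∀ w : ℕ → Four, (φ.eval w).fst = (ψ.eval w).fst)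
    (w : ℕ → A) : φ.eval w ∈ F ↔ ψ.eval w ∈ F :=
  ⟨hF.mem_of_mem φ ψ (fun w' => by rw [hrule w']; exact id) w,
    hF.mem_of_mem ψ φ (fun w' => by rw [hrule w']; exact id) w⟩

theorem IsModelLB.mem_of_mem_of_mem {F : Set A} (hF : IsModelLB F) (φ φ' ψ : Fm)
    (hrule : ∀ w : ℕ → Four, (φ.eval w).fst = true → (φ'.eval w).fst = true →
      (ψ.eval w).fst = true)
    (w : ℕ → A) (hw : φ.eval w ∈ F) (hw' : φ'.eval w ∈ F) : ψ.eval w ∈ F :=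
  hF.mem_of_rule {φ, φ'} ψ (fun v hv => hrule v (hv φ (by simp)) (hv φ' (by simp))) w
    (by rintro γ (rfl | rfl) <;> assumption)

end Eval

/-! Calculation rules in product bilattices over the two-element lattice. -/

namespace Four

variable (a b : Four)

theorem tmeet_fst : (a ⋏ b).fst = (a.fst && b.fst) := rfl
theorem tmeet_snd : (a ⋏ b).snd = (a.snd || b.snd) := rfl
theorem tjoin_fst : (a ⋎ b).fst = (a.fst || b.fst) := rfl
theorem tjoin_snd : (a ⋎ b).snd = (a.snd && b.snd) := rfl
theorem kmeet_fst : (a ⊗ₖ b).fst = (a.fst && b.fst) := rfl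
theorem kmeet_snd : (a ⊗ₖ b).snd = (a.snd && b.snd) := rfl
theorem kjoin_fst : (a ⊕ₖ b).fst = (a.fst || b.fst) := rfl
theorem kjoin_snd : (a ⊕ₖ b).snd = (a.snd || b.snd) := rfl
theorem neg_fst : (∼a).fst = a.snd := rfl
theorem neg_snd : (∼a).snd = a.fst := rfl

attribute [simp] tmeet_fst tmeet_snd tjoin_fst tjoin_snd kmeet_fst kmeet_snd kjoin_fst kjoin_snd
  neg_fst neg_snd
attribute [grind =] tmeet_fst tmeet_snd tjoin_fst tjoin_snd kmeet_fst kmeet_snd kjoin_fst kjoin_snd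
  neg_fst neg_snd

end Four

attribute [grind ext] ProductBilattice.ext

section Eval

variable {A : Type u} [BilatAlgebra A] (w : ℕ → A)

@[simp, grind =] theorem Fm.eval_var (n : ℕ) : (Fm.var n).eval w = w n := rfl
@[simp, grind =] theorem Fm.eval_tmeet (p q : Fm) : (p ⋏ q).eval w = p.eval w ⋏ q.eval w := rfl
@[simp, grind =] theorem Fm.eval_tjoin (p q : Fm) : (p ⋎ q).eval w = p.eval w ⋎ q.eval w := rfl
@[simp, grind =] theorem Fm.eval_kmeet (p q : Fm) : (p ⊗ₖ q).eval w = p.eval w ⊗ₖ q.eval w := rfl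
@[simp, grind =] theorem Fm.eval_kjoin (p q : Fm) : (p ⊕ₖ q).eval w = p.eval w ⊕ₖ q.eval w := rfl
@[simp, grind =] theorem Fm.eval_neg (p : Fm) : (∼p).eval w = ∼(p.eval w) := rfl

theorem Fm.eval_eval (σ : ℕ → Fm) (p : Fm) :
    (p.eval σ).eval w = p.eval fun n => (σ n).eval w :=
  ((Fm.isHom_eval w).comp (Fm.isHom_eval σ)).eq_eval p

end Eval

/-- The assignment that sends the first two variables to `a` and `b`, and the others to `c`. -/
def assign {A : Type u} (a b c : A) : ℕ → A
  | 0 => a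
  | 1 => b
  | _ => c

local notation "x₀" => Fm.var 0
local notation "x₁" => Fm.var 1
local notation "x₂" => Fm.var 2

/-! ### Rules of `LB` and the Leibniz congruence of its models. -/

section Model

variable {A : Type u} [BilatAlgebra A] {F : Set A}

namespace IsModelLB

theorem tmeet_mem_iff (hF : IsModelLB F) (a b : A) : a ⋏ b ∈ F ↔ a ∈ F ∧ b ∈ F :=
  ⟨fun hab => ⟨hF.mem_of_mem (x₀ ⋏ x₁) x₀ (fun w => by simp +contextual) (assign a b b) hab,
    hF.mem_of_mem (x₀ ⋏ x₁) x₁ (fun w => by simp +contextual) (assign a b b) hab⟩,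
    fun hab => hF.mem_of_mem_of_mem x₀ x₁ (x₀ ⋏ x₁) (fun w => by simp +contextual)
      (assign a b b) hab.1 hab.2⟩

theorem kmeet_mem_iff (hF : IsModelLB F) (a b : A) : a ⊗ₖ b ∈ F ↔ a ∈ F ∧ b ∈ F :=
  (hF.mem_iff_mem (x₀ ⊗ₖ x₁) (x₀ ⋏ x₁) (fun w => by simp) (assign a b b)).trans
    (hF.tmeet_mem_iff a b)

theorem tjoin_mem (hF : IsModelLB F) {a : A} (ha : a ∈ F) (b : A) : a ⋎ b ∈ F :=
  hF.mem_of_mem x₀ (x₀ ⋎ x₁) (fun w => by simp +contextual) (assign a b b) ha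

theorem kjoin_mem (hF : IsModelLB F) {a : A} (ha : a ∈ F) (b : A) : a ⊕ₖ b ∈ F :=
  hF.mem_of_mem x₀ (x₀ ⊕ₖ x₁) (fun w => by simp +contextual) (assign a b b) ha

theorem tjoin_self_mem_iff (hF : IsModelLB F) (a : A) : a ⋎ a ∈ F ↔ a ∈ F :=
  hF.mem_iff_mem (x₀ ⋎ x₀) x₀ (fun w => by simp) (assign a a a)

theorem tjoin_comm_mem_iff (hF : IsModelLB F) (a b : A) : a ⋎ b ∈ F ↔ b ⋎ a ∈ F :=
  hF.mem_iff_mem (x₀ ⋎ x₁) (x₁ ⋎ x₀) (fun w => by grind) (assign a b b)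

theorem tjoin_left_comm_mem_iff (hF : IsModelLB F) (a b c : A) :
    a ⋎ (b ⋎ c) ∈ F ↔ b ⋎ (a ⋎ c) ∈ F :=
  hF.mem_iff_mem (x₀ ⋎ (x₁ ⋎ x₂)) (x₁ ⋎ (x₀ ⋎ x₂)) (fun w => by grind) (assign a b c)

/-- This rule and those below push each connective, plain or negated, out of a context `_ ⋎ c`; they
are what makes `SameJoins` a congruence. -/
theorem tmeet_tjoin_mem_iff (hF : IsModelLB F) (a b c : A) :
    (a ⋏ b) ⋎ c ∈ F ↔ a ⋎ c ∈ F ∧ b ⋎ c ∈ F :=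
  (hF.mem_iff_mem ((x₀ ⋏ x₁) ⋎ x₂) ((x₀ ⋎ x₂) ⋏ (x₁ ⋎ x₂)) (fun w => by grind)
    (assign a b c)).trans (hF.tmeet_mem_iff _ _)

theorem neg_tmeet_tjoin_mem_iff (hF : IsModelLB F) (a b c : A) :
    ∼(a ⋏ b) ⋎ c ∈ F ↔ ∼a ⋎ (∼b ⋎ c) ∈ F :=
  hF.mem_iff_mem (∼(x₀ ⋏ x₁) ⋎ x₂) (∼x₀ ⋎ (∼x₁ ⋎ x₂)) (fun w => by grind) (assign a b c)

theorem tjoin_tjoin_mem_iff (hF : IsModelLB F) (a b c : A) :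
    (a ⋎ b) ⋎ c ∈ F ↔ a ⋎ (b ⋎ c) ∈ F :=
  hF.mem_iff_mem ((x₀ ⋎ x₁) ⋎ x₂) (x₀ ⋎ (x₁ ⋎ x₂)) (fun w => by grind) (assign a b c)

theorem neg_tjoin_tjoin_mem_iff (hF : IsModelLB F) (a b c : A) :
    ∼(a ⋎ b) ⋎ c ∈ F ↔ ∼a ⋎ c ∈ F ∧ ∼b ⋎ c ∈ F :=
  (hF.mem_iff_mem (∼(x₀ ⋎ x₁) ⋎ x₂) ((∼x₀ ⋎ x₂) ⋏ (∼x₁ ⋎ x₂)) (fun w => by grind)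
    (assign a b c)).trans (hF.tmeet_mem_iff _ _)

theorem kmeet_tjoin_mem_iff (hF : IsModelLB F) (a b c : A) :
    (a ⊗ₖ b) ⋎ c ∈ F ↔ a ⋎ c ∈ F ∧ b ⋎ c ∈ F :=
  (hF.mem_iff_mem ((x₀ ⊗ₖ x₁) ⋎ x₂) ((x₀ ⋎ x₂) ⋏ (x₁ ⋎ x₂)) (fun w => by grind)
    (assign a b c)).trans (hF.tmeet_mem_iff _ _)

theorem neg_kmeet_tjoin_mem_iff (hF : IsModelLB F) (a b c : A) :
    ∼(a ⊗ₖ b) ⋎ c ∈ F ↔ ∼a ⋎ c ∈ F ∧ ∼b ⋎ c ∈ F :=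
  (hF.mem_iff_mem (∼(x₀ ⊗ₖ x₁) ⋎ x₂) ((∼x₀ ⋎ x₂) ⋏ (∼x₁ ⋎ x₂)) (fun w => by grind)
    (assign a b c)).trans (hF.tmeet_mem_iff _ _)

theorem kjoin_tjoin_mem_iff (hF : IsModelLB F) (a b c : A) :
    (a ⊕ₖ b) ⋎ c ∈ F ↔ a ⋎ (b ⋎ c) ∈ F :=
  hF.mem_iff_mem ((x₀ ⊕ₖ x₁) ⋎ x₂) (x₀ ⋎ (x₁ ⋎ x₂)) (fun w => by grind) (assign a b c)

theorem neg_kjoin_tjoin_mem_iff (hF : IsModelLB F) (a b c : A) :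
    ∼(a ⊕ₖ b) ⋎ c ∈ F ↔ ∼a ⋎ (∼b ⋎ c) ∈ F :=
  hF.mem_iff_mem (∼(x₀ ⊕ₖ x₁) ⋎ x₂) (∼x₀ ⋎ (∼x₁ ⋎ x₂)) (fun w => by grind) (assign a b c)

theorem neg_neg_tjoin_mem_iff (hF : IsModelLB F) (a c : A) : ∼(∼a) ⋎ c ∈ F ↔ a ⋎ c ∈ F :=
  hF.mem_iff_mem (∼(∼x₀) ⋎ x₁) (x₀ ⋎ x₁) (fun w => by grind) (assign a c c)

end IsModelLB

/-- The relation that describes the Leibniz congruence of a model of `LB`. -/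
def SameJoins (F : Set A) (a b : A) : Prop :=
  ∀ c : A, (a ⋎ c ∈ F ↔ b ⋎ c ∈ F) ∧ (∼a ⋎ c ∈ F ↔ ∼b ⋎ c ∈ F)

theorem SameJoins.symm {a b : A} (hab : SameJoins F a b) : SameJoins F b a :=
  fun c => ⟨(hab c).1.symm, (hab c).2.symm⟩

/-- A compatible congruence is preserved by the contexts `_ ⋎ c` and `∼_ ⋎ c`. -/
theorem IsMatrixCongruence.sameJoins {η : A → A → Prop} (hη : IsMatrixCongruence F η) {a b : A}
    (hab : η a b) : SameJoins F a b := by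
  obtain ⟨hη, hc⟩ := hη
  have key : ∀ x y, η x y → ∀ c, x ⋎ c ∈ F ↔ y ⋎ c ∈ F := fun x y hxy c =>
    have hxy' := hη.tjoin x y c c hxy (hη.equivalence.refl c)
    ⟨fun hx => hc _ _ hx hxy', fun hy => hc _ _ hy (hη.equivalence.symm hxy')⟩
  exact fun c => ⟨key a b hab c, key _ _ (hη.neg a b hab) c⟩

theorem IsModelLB.isMatrixCongruence_sameJoins (hF : IsModelLB F) :
    IsMatrixCongruence F (SameJoins F) := by
  refine ⟨⟨⟨fun a c => ⟨Iff.rfl, Iff.rfl⟩, SameJoins.symm, fun {a b d} hab hbd c =>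
    ⟨(hab c).1.trans (hbd c).1, (hab c).2.trans (hbd c).2⟩⟩, ?_, ?_, ?_, ?_, ?_⟩, ?_⟩
  · refine fun a a' b b' ha hb c => ⟨?_, ?_⟩
    · rw [hF.tmeet_tjoin_mem_iff, hF.tmeet_tjoin_mem_iff, (ha c).1, (hb c).1]
    -- Replace `a` in the context `∼b ⋎ c`, permute the disjuncts, then replace `b` in the context
    -- `∼a' ⋎ c`.
    · rw [hF.neg_tmeet_tjoin_mem_iff, hF.neg_tmeet_tjoin_mem_iff, (ha _).2,
        hF.tjoin_left_comm_mem_iff, (hb _).2, hF.tjoin_left_comm_mem_iff]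
  · refine fun a a' b b' ha hb c => ⟨?_, ?_⟩
    · rw [hF.tjoin_tjoin_mem_iff, hF.tjoin_tjoin_mem_iff, (ha _).1,
        hF.tjoin_left_comm_mem_iff, (hb _).1, hF.tjoin_left_comm_mem_iff]
    · rw [hF.neg_tjoin_tjoin_mem_iff, hF.neg_tjoin_tjoin_mem_iff, (ha c).2, (hb c).2]
  · refine fun a a' b b' ha hb c => ⟨?_, ?_⟩
    · rw [hF.kmeet_tjoin_mem_iff, hF.kmeet_tjoin_mem_iff, (ha c).1, (hb c).1]
    · rw [hF.neg_kmeet_tjoin_mem_iff, hF.neg_kmeet_tjoin_mem_iff, (ha c).2, (hb c).2]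
  · refine fun a a' b b' ha hb c => ⟨?_, ?_⟩
    · rw [hF.kjoin_tjoin_mem_iff, hF.kjoin_tjoin_mem_iff, (ha _).1,
        hF.tjoin_left_comm_mem_iff, (hb _).1, hF.tjoin_left_comm_mem_iff]
    · rw [hF.neg_kjoin_tjoin_mem_iff, hF.neg_kjoin_tjoin_mem_iff, (ha _).2,
        hF.tjoin_left_comm_mem_iff, (hb _).2, hF.tjoin_left_comm_mem_iff]
  · refine fun a a' ha c => ⟨(ha c).2, ?_⟩
    rw [hF.neg_neg_tjoin_mem_iff, hF.neg_neg_tjoin_mem_iff, (ha c).1]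
  · intro a b ha hab
    -- Compatibility comes from the context `c = b`: membership of `b` is that of `b ⋎ b`, hence of
    -- `a ⋎ b`.
    rw [← hF.tjoin_self_mem_iff, ← (hab b).1]
    exact hF.tjoin_mem ha b

/-- A model is reduced if and only if `SameJoins` is the identity. -/
theorem isReducedModelLB_iff :
    IsReducedModelLB F ↔ IsModelLB F ∧ ∀ a b, SameJoins F a b → a = b := by
  refine and_congr_right fun hF => ⟨fun h a b => h.2 _ hF.isMatrixCongruence_sameJoins a b,
    fun h => ⟨⟨⟨eq_equivalence, ?_, ?_, ?_, ?_, ?_⟩, ?_⟩, fun η hη a b hab =>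
      h a b (hη.sameJoins hab)⟩⟩
  all_goals intros; subst_vars; first | rfl | assumption

/-- For empty `F` all elements are related by `SameJoins`. -/
theorem IsReducedModelLB.nonempty [Nontrivial A] (hF : IsReducedModelLB F) : F.Nonempty := by
  by_contra hne
  obtain ⟨a, b, hab⟩ := exists_pair_ne A
  refine hab ((isReducedModelLB_iff.1 hF).2 a b ?_)
  rw [Set.not_nonempty_iff_eq_empty] at hne
  subst hne
  exact fun c => ⟨Iff.rfl, Iff.rfl⟩

/-- The algebra of a reduced model satisfies the identities of `FOUR`. -/
theorem IsReducedModelLB.eval_eq_eval (hF : IsReducedModelLB F) (p q : Fm)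
    (hpq : ∀ w : ℕ → Four, p.eval w = q.eval w) (w : ℕ → A) : p.eval w = q.eval w := by
  rw [isReducedModelLB_iff] at hF
  refine hF.2 _ _ fun c => ?_
  -- Shifting the variables of `p` and `q` by one frees variable `0` to denote the context `c`.
  let w' : ℕ → A := fun n => n.casesOn c w
  have key : ∀ r : Fm, (r.eval fun n => Fm.var (n + 1)).eval w' = r.eval w :=
    fun r => Fm.eval_eval w' _ r
  rw [← key p, ← key q]
  exact ⟨hF.1.mem_iff_mem (p.eval (fun n => Fm.var (n + 1)) ⋎ x₀)
      (q.eval (fun n => Fm.var (n + 1)) ⋎ x₀)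
      (fun v => by simp only [Fm.eval_tjoin, Fm.eval_eval, hpq]) w',
    hF.1.mem_iff_mem (∼(p.eval (fun n => Fm.var (n + 1))) ⋎ x₀)
      (∼(q.eval (fun n => Fm.var (n + 1))) ⋎ x₀)
      (fun v => by simp only [Fm.eval_tjoin, Fm.eval_neg, Fm.eval_eval, hpq]) w'⟩

/-- The axioms are identities valid in `FOUR`, apart from the two order conditions on negation,
which follow from the identities for `∼(a ⋏ b)` and `∼(a ⊗ₖ b)`. -/
theorem IsReducedModelLB.isDistributiveBilattice (hF : IsReducedModelLB F) :
    IsDistributiveBilattice A := by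
  have H : ∀ p q : Fm, (∀ w : ℕ → Four, p.eval w = q.eval w) → ∀ a b c : A,
      p.eval (assign a b c) = q.eval (assign a b c) :=
    fun p q hpq a b c => hF.eval_eq_eval p q hpq _
  have T : IsLatticePair (BilatAlgebra.tmeet (A := A)) BilatAlgebra.tjoin :=
    { meet_comm := fun a b => H (x₀ ⋏ x₁) (x₁ ⋏ x₀) (by grind) a b b
      meet_assoc := H ((x₀ ⋏ x₁) ⋏ x₂) (x₀ ⋏ (x₁ ⋏ x₂)) (by grind)
      join_comm := fun a b => H (x₀ ⋎ x₁) (x₁ ⋎ x₀) (by grind) a b b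
      join_assoc := H ((x₀ ⋎ x₁) ⋎ x₂) (x₀ ⋎ (x₁ ⋎ x₂)) (by grind)
      meet_join_self := fun a b => H (x₀ ⋏ (x₀ ⋎ x₁)) x₀ (by grind) a b b
      join_meet_self := fun a b => H (x₀ ⋎ (x₀ ⋏ x₁)) x₀ (by grind) a b b }
  have K : IsLatticePair (BilatAlgebra.kmeet (A := A)) BilatAlgebra.kjoin :=
    { meet_comm := fun a b => H (x₀ ⊗ₖ x₁) (x₁ ⊗ₖ x₀) (by grind) a b b
      meet_assoc := H ((x₀ ⊗ₖ x₁) ⊗ₖ x₂) (x₀ ⊗ₖ (x₁ ⊗ₖ x₂)) (by grind)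
      join_comm := fun a b => H (x₀ ⊕ₖ x₁) (x₁ ⊕ₖ x₀) (by grind) a b b
      join_assoc := H ((x₀ ⊕ₖ x₁) ⊕ₖ x₂) (x₀ ⊕ₖ (x₁ ⊕ₖ x₂)) (by grind)
      meet_join_self := fun a b => H (x₀ ⊗ₖ (x₀ ⊕ₖ x₁)) x₀ (by grind) a b b
      join_meet_self := fun a b => H (x₀ ⊕ₖ (x₀ ⊗ₖ x₁)) x₀ (by grind) a b b }
  exact
    { truth_lattice := T
      knowledge_lattice := K
      neg_antitone_truth := fun a b hab => by
        have e : ∼a = ∼a ⋎ ∼b := by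
          have : ∼(a ⋏ b) = ∼a ⋎ ∼b := H (∼(x₀ ⋏ x₁)) (∼x₀ ⋎ ∼x₁) (by grind) a b b
          rwa [show a ⋏ b = a from hab] at this
        rw [LeT, e, T.join_comm, T.meet_join_self]
      neg_monotone_knowledge := fun a b hab => by
        have : ∼(a ⊗ₖ b) = ∼a ⊗ₖ ∼b := H (∼(x₀ ⊗ₖ x₁)) (∼x₀ ⊗ₖ ∼x₁) (by grind) a b b
        rw [show a ⊗ₖ b = a from hab] at this
        exact this.symm
      neg_neg := fun a => H (∼(∼x₀)) x₀ (by grind) a a a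
      tmeet_tjoin := H (x₀ ⋏ (x₁ ⋎ x₂)) ((x₀ ⋏ x₁) ⋎ (x₀ ⋏ x₂)) (by grind)
      tmeet_kmeet := H (x₀ ⋏ (x₁ ⊗ₖ x₂)) ((x₀ ⋏ x₁) ⊗ₖ (x₀ ⋏ x₂)) (by grind)
      tmeet_kjoin := H (x₀ ⋏ (x₁ ⊕ₖ x₂)) ((x₀ ⋏ x₁) ⊕ₖ (x₀ ⋏ x₂)) (by grind)
      tjoin_tmeet := H (x₀ ⋎ (x₁ ⋏ x₂)) ((x₀ ⋎ x₁) ⋏ (x₀ ⋎ x₂)) (by grind)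
      tjoin_kmeet := H (x₀ ⋎ (x₁ ⊗ₖ x₂)) ((x₀ ⋎ x₁) ⊗ₖ (x₀ ⋎ x₂)) (by grind)
      tjoin_kjoin := H (x₀ ⋎ (x₁ ⊕ₖ x₂)) ((x₀ ⋎ x₁) ⊕ₖ (x₀ ⋎ x₂)) (by grind)
      kmeet_tmeet := H (x₀ ⊗ₖ (x₁ ⋏ x₂)) ((x₀ ⊗ₖ x₁) ⋏ (x₀ ⊗ₖ x₂)) (by grind)
      kmeet_tjoin := H (x₀ ⊗ₖ (x₁ ⋎ x₂)) ((x₀ ⊗ₖ x₁) ⋎ (x₀ ⊗ₖ x₂)) (by grind)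
      kmeet_kjoin := H (x₀ ⊗ₖ (x₁ ⊕ₖ x₂)) ((x₀ ⊗ₖ x₁) ⊕ₖ (x₀ ⊗ₖ x₂)) (by grind)
      kjoin_tmeet := H (x₀ ⊕ₖ (x₁ ⋏ x₂)) ((x₀ ⊕ₖ x₁) ⋏ (x₀ ⊕ₖ x₂)) (by grind)
      kjoin_tjoin := H (x₀ ⊕ₖ (x₁ ⋎ x₂)) ((x₀ ⊕ₖ x₁) ⋎ (x₀ ⊕ₖ x₂)) (by grind)
      kjoin_kmeet := H (x₀ ⊕ₖ (x₁ ⊗ₖ x₂)) ((x₀ ⊕ₖ x₁) ⊗ₖ (x₀ ⊕ₖ x₂)) (by grind) }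

theorem IsReducedModelLB.isBifilter [Nontrivial A] (hF : IsReducedModelLB F) : IsBifilter F where
  nonempty := hF.nonempty
  tmeet_mem a ha b hb := (hF.1.tmeet_mem_iff a b).2 ⟨ha, hb⟩
  kmeet_mem a ha b hb := (hF.1.kmeet_mem_iff a b).2 ⟨ha, hb⟩
  mem_of_leT a ha b hab := ((hF.1.tmeet_mem_iff a b).1 (by rwa [show a ⋏ b = a from hab])).2
  mem_of_leK a ha b hab := ((hF.1.kmeet_mem_iff a b).1 (by rwa [show a ⊗ₖ b = a from hab])).2

end Model

/-! The regular part of an element. -/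

/-- In a product bilattice, this is the map `(a₁, a₂) ↦ (a₁, a₁)`. -/
def regPart {A : Type u} [BilatAlgebra A] (a : A) : A :=
  (a ⋎ (a ⊗ₖ ∼a)) ⊕ₖ ∼(a ⋎ (a ⊗ₖ ∼a))

@[simp, grind =] theorem Four.regPart_fst (a : Four) : (regPart a).fst = a.fst := by
  grind [regPart]

@[simp, grind =] theorem Four.regPart_snd (a : Four) : (regPart a).snd = a.fst := by
  grind [regPart]

section RegPart

variable {A : Type u} [BilatAlgebra A]

theorem IsHom.map_regPart {B : Type v} [BilatAlgebra B] {f : A → B} (hf : IsHom f) (a : A) :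
    f (regPart a) = regPart (f a) := by
  simp only [regPart, hf.map_tjoin, hf.map_kmeet, hf.map_kjoin, hf.map_neg]

/-- In `FOUR`, `regPart` keeps the first coordinate, and `Tr` looks at nothing else. -/
theorem IsModelLB.regPart_mem_iff {F : Set A} (hF : IsModelLB F) (a : A) :
    regPart a ∈ F ↔ a ∈ F :=
  hF.mem_iff_mem (regPart (Fm.var 0)) (Fm.var 0)
    (fun w => by rw [(Fm.isHom_eval w).map_regPart]; simp) (assign a a a)

theorem bifilterGen_subset {X F : Set A} (hF : IsBifilter F) (hX : X ⊆ F) : bifilterGen X ⊆ F :=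
  Set.sInter_subset_of_mem ⟨hF, hX⟩

theorem subset_bifilterGen (X : Set A) : X ⊆ bifilterGen X :=
  Set.subset_sInter fun _ hF => hF.2

theorem isBifilter_bifilterGen {X : Set A} (hX : X.Nonempty) : IsBifilter (bifilterGen X) where
  nonempty := hX.mono (subset_bifilterGen X)
  tmeet_mem a ha b hb G hG := hG.1.tmeet_mem a (ha G hG) b (hb G hG)
  kmeet_mem a ha b hb G hG := hG.1.kmeet_mem a (ha G hG) b (hb G hG)
  mem_of_leT a ha b hab G hG := hG.1.mem_of_leT a (ha G hG) b hab
  mem_of_leK a ha b hab G hG := hG.1.mem_of_leK a (ha G hG) b hab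

section

variable [h : IsDistributiveBilattice A]

/-- This and the following laws are checked in `FOUR`, whose homomorphisms separate points. -/
theorem neg_regPart (a : A) : ∼(regPart a) = regPart a :=
  eq_of_forall_isHom_four fun f hf => by
    simp only [hf.map_neg, hf.map_regPart]
    grind

theorem regPart_of_neg_eq {a : A} (ha : ∼a = a) : regPart a = a :=
  eq_of_forall_isHom_four fun f hf => by
    have := congrArg f ha
    simp only [hf.map_neg, hf.map_regPart] at *
    grind

theorem regPart_tmeet (a b : A) : regPart (a ⋏ b) = regPart a ⊗ₖ regPart b :=
  eq_of_forall_isHom_four fun f hf => by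
    simp only [hf.map_tmeet, hf.map_kmeet, hf.map_regPart]
    grind

theorem regPart_tjoin (a b : A) : regPart (a ⋎ b) = regPart a ⊕ₖ regPart b :=
  eq_of_forall_isHom_four fun f hf => by
    simp only [hf.map_tjoin, hf.map_kjoin, hf.map_regPart]
    grind

theorem regPart_kmeet (a b : A) : regPart (a ⊗ₖ b) = regPart a ⊗ₖ regPart b :=
  eq_of_forall_isHom_four fun f hf => by
    simp only [hf.map_kmeet, hf.map_regPart]
    grind

theorem regPart_kjoin (a b : A) : regPart (a ⊕ₖ b) = regPart a ⊕ₖ regPart b :=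
  eq_of_forall_isHom_four fun f hf => by
    simp only [hf.map_kjoin, hf.map_regPart]
    grind

theorem eq_of_regPart_eq {a b : A} (h₁ : regPart a = regPart b)
    (h₂ : regPart (∼a) = regPart (∼b)) : a = b :=
  eq_of_forall_isHom_four fun f hf => by
    have e₁ := congrArg f h₁
    have e₂ := congrArg f h₂
    simp only [hf.map_neg, hf.map_regPart] at e₁ e₂
    have e₃ := Four.regPart_fst (f a)
    have e₄ := Four.regPart_fst (∼(f a))
    rw [e₁] at e₃
    rw [e₂] at e₄
    grind

theorem LeK.regPart {a b : A} (hab : LeK a b) : LeK (regPart a) (regPart b) := by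
  unfold LeK at *
  rw [← regPart_kmeet, hab]

/-- The element with given first and second components. -/
theorem exists_regPart_eq {a b : A} (ha : ∼a = a) (hb : ∼b = b) :
    ∃ c : A, regPart c = a ∧ regPart (∼c) = b := by
  -- For `a = (x, x)` and `b = (y, y)` the two summands are `(x, x ⊓ y)` and `(x ⊓ y, y)`, with sum
  -- `(x, y)`.
  refine ⟨(a ⊗ₖ (a ⋎ b)) ⊕ₖ (b ⊗ₖ (a ⋏ b)), ?_, ?_⟩ <;>
  · refine eq_of_forall_isHom_four fun f hf => ?_
    have e₁ := congrArg f ha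
    have e₂ := congrArg f hb
    simp only [hf.map_tmeet, hf.map_tjoin, hf.map_kmeet, hf.map_kjoin, hf.map_neg,
      hf.map_regPart] at *
    grind

/-- The regular part, as a regular element. -/
def toReg (a : A) : Reg A := ⟨regPart a, neg_regPart a⟩

/-- A distributive bilattice is the product bilattice of its lattice of regular elements. -/
theorem isomorphic_productBilattice_reg : Isomorphic A (ProductBilattice (Reg A)) := by
  refine ⟨fun a => ⟨toReg a, toReg (∼a)⟩, ⟨fun a b => ?_, fun a b => ?_, fun a b => ?_,
    fun a b => ?_, fun a => ?_⟩, fun a b hab => ?_, fun x => ?_⟩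
  · refine ProductBilattice.ext (Subtype.ext (regPart_tmeet a b)) (Subtype.ext ?_)
    exact (congrArg regPart (neg_tmeet a b)).trans (regPart_tjoin (∼a) (∼b))
  · refine ProductBilattice.ext (Subtype.ext (regPart_tjoin a b)) (Subtype.ext ?_)
    exact (congrArg regPart (neg_tjoin a b)).trans (regPart_tmeet (∼a) (∼b))
  · refine ProductBilattice.ext (Subtype.ext (regPart_kmeet a b)) (Subtype.ext ?_)
    exact (congrArg regPart (neg_kmeet_of_isBilattice a b)).trans (regPart_kmeet (∼a) (∼b))
  · refine ProductBilattice.ext (Subtype.ext (regPart_kjoin a b)) (Subtype.ext ?_)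
    exact (congrArg regPart (neg_kjoin_of_isBilattice a b)).trans (regPart_kjoin (∼a) (∼b))
  · refine ProductBilattice.ext rfl (Subtype.ext ?_)
    exact congrArg regPart (h.neg_neg a)
  · exact eq_of_regPart_eq (congrArg (fun p => p.fst.1) hab) (congrArg (fun p => p.snd.1) hab)
  · obtain ⟨c, hc₁, hc₂⟩ := exists_regPart_eq x.fst.2 x.snd.2
    exact ⟨c, ProductBilattice.ext (Subtype.ext hc₁) (Subtype.ext hc₂)⟩

/-- The bifilter generated by the top regular element. -/
theorem mem_bifilterGen_top_iff {t : Reg A} (ht : ∀ x : Reg A, x ≤ t) (a : A) :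
    a ∈ bifilterGen {t.1} ↔ regPart a = t.1 := by
  constructor
  · have hF : IsBifilter {b : A | regPart b = t.1} := by
      have up : ∀ x y : A, regPart x = t.1 → LeK (regPart x) (regPart y) → regPart y = t.1 :=
        fun x y hx hxy => LeK.antisymm (ht (toReg y)) (hx ▸ hxy)
      refine ⟨⟨t.1, regPart_of_neg_eq t.2⟩, fun x hx y hy => ?_, fun x hx y hy => ?_,
        fun x hx y hxy => up x y hx ?_, fun x hx y hxy => up x y hx hxy.regPart⟩
      · rw [Set.mem_ofPred_eq] at *
        rw [regPart_tmeet, hx, hy]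
        -- The goal `t ⊗ t = t` is `t ≤ t` unfolded.
        exact le_refl t
      · rw [Set.mem_ofPred_eq] at *
        rw [regPart_kmeet, hx, hy]
        exact le_refl t
      · rw [LeK, ← regPart_tmeet, hxy]
    exact fun ha => bifilterGen_subset hF (Set.singleton_subset_iff.2 (regPart_of_neg_eq t.2)) ha
  · rintro ha G ⟨hG, htG⟩
    -- A bifilter is a model, so it contains `a` as soon as it contains the regular part of `a`.
    rw [← hG.isModelLB.regPart_mem_iff, ha]
    exact htG rfl

end

end RegPart

/-! ### The equivalent descriptions of reduced models. -/

section Characterization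

variable {A : Type u} [BilatAlgebra A] {F : Set A}

/-- Monotonicity gives one implication in each half of `SameJoins`, so being unrelated means that
one of the converses fails for some `c`. -/
theorem IsReducedModelLB.exists_separating_of_ltT (hF : IsReducedModelLB F) {a b : A}
    (hab : LtT a b) :
    ∃ c : A, (a ⋎ c ∉ F ∧ b ⋎ c ∈ F) ∨ (∼a ⋎ c ∈ F ∧ ∼b ⋎ c ∉ F) := by
  obtain ⟨hM, hred⟩ := isReducedModelLB_iff.1 hF
  by_contra hcon
  push Not at hcon
  refine hab.2 (hred a b fun c => ⟨⟨fun hc => ?_, not_imp_not.1 ((hcon c).1)⟩,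
    (hcon c).2, fun hc => ?_⟩)
  · rw [← show a ⋏ b = a from hab.1, hM.tmeet_tjoin_mem_iff] at hc
    exact hc.2
  · rw [← show a ⋏ b = a from hab.1, hM.neg_tmeet_tjoin_mem_iff, hM.tjoin_comm_mem_iff]
    exact hM.tjoin_mem hc _

theorem IsReducedModelLB.exists_separating_of_ltK (hF : IsReducedModelLB F) {a b : A}
    (hab : LtK a b) :
    ∃ c : A, (a ⋎ c ∉ F ∧ b ⋎ c ∈ F) ∨ (∼a ⋎ c ∉ F ∧ ∼b ⋎ c ∈ F) := by
  obtain ⟨hM, hred⟩ := isReducedModelLB_iff.1 hF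
  by_contra hcon
  push Not at hcon
  refine hab.2 (hred a b fun c => ⟨⟨fun hc => ?_, not_imp_not.1 ((hcon c).1)⟩,
    fun hc => ?_, not_imp_not.1 ((hcon c).2)⟩)
  · rw [← show a ⊗ₖ b = a from hab.1, hM.kmeet_tjoin_mem_iff] at hc
    exact hc.2
  · rw [← show a ⊗ₖ b = a from hab.1, hM.neg_kmeet_tjoin_mem_iff] at hc
    exact hc.2

theorem isReducedModelLB_of_separating_ltT [h : IsDistributiveBilattice A] (hF : IsBifilter F)
    (hsep : ∀ a b : A, LtT a b → ∃ c : A,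
      (a ⋎ c ∉ F ∧ b ⋎ c ∈ F) ∨ (∼a ⋎ c ∈ F ∧ ∼b ⋎ c ∉ F)) : IsReducedModelLB F := by
  have T := h.truth_lattice
  have key : ∀ a b : A, SameJoins F a b → LeT a b → a = b := by
    intro a b hab hle
    by_contra hne
    obtain ⟨c, hc | hc⟩ := hsep a b ⟨hle, hne⟩
    · exact hc.1 ((hab c).1.2 hc.2)
    · exact hc.2 ((hab c).2.1 hc.1)
  refine isReducedModelLB_iff.2 ⟨hF.isModelLB, fun a b hab => ?_⟩
  -- Separation only treats comparable pairs; a related pair `a`, `b` is compared through its meet,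
  -- which is related to both.
  have hC := hF.isModelLB.isMatrixCongruence_sameJoins.1
  have h₁ := hC.tmeet a b a a hab (hC.equivalence.refl a)
  have h₂ := hC.tmeet a b b b hab (hC.equivalence.refl b)
  rw [tmeet_self] at h₁ h₂
  have e₁ := key (b ⋏ a) a h₁.symm (by rw [LeT, T.meet_assoc, tmeet_self])
  have e₂ := key (a ⋏ b) b h₂ (by rw [LeT, T.meet_assoc, tmeet_self])
  rw [← e₁, T.meet_comm, e₂]

theorem isReducedModelLB_of_separating_ltK [h : IsDistributiveBilattice A] (hF : IsBifilter F)
    (hsep : ∀ a b : A, LtK a b → ∃ c : A,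
      (a ⋎ c ∉ F ∧ b ⋎ c ∈ F) ∨ (∼a ⋎ c ∉ F ∧ ∼b ⋎ c ∈ F)) : IsReducedModelLB F := by
  have K := h.knowledge_lattice
  have key : ∀ a b : A, SameJoins F a b → LeK a b → a = b := by
    intro a b hab hle
    by_contra hne
    obtain ⟨c, hc | hc⟩ := hsep a b ⟨hle, hne⟩
    · exact hc.1 ((hab c).1.2 hc.2)
    · exact hc.1 ((hab c).2.2 hc.2)
  refine isReducedModelLB_iff.2 ⟨hF.isModelLB, fun a b hab => ?_⟩
  have hC := hF.isModelLB.isMatrixCongruence_sameJoins.1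
  have h₁ := hC.kmeet a b a a hab (hC.equivalence.refl a)
  have h₂ := hC.kmeet a b b b hab (hC.equivalence.refl b)
  rw [kmeet_self] at h₁ h₂
  have e₁ := key (b ⊗ₖ a) a h₁.symm (kmeet_leK_right b a)
  have e₂ := key (a ⊗ₖ b) b h₂ (kmeet_leK_right a b)
  rw [← e₁, K.meet_comm, e₂]

/-- In a reduced model, the regular elements form a dual disjunctive lattice, whose top element
generates the designated bifilter. -/
theorem IsReducedModelLB.exists_isDualDisjunctive [h : IsDistributiveBilattice A]
    (hF : IsReducedModelLB F) (hB : IsBifilter F) :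
    ∃ t : Reg A, IsDualDisjunctive (Reg A) t ∧ F = bifilterGen {t.1} := by
  obtain ⟨hM, hred⟩ := isReducedModelLB_iff.1 hF
  -- All joins with a member of `F` lie in `F`, and negation fixes regular elements, so two regular
  -- members are related.
  have huniq : ∀ x y : Reg A, x.1 ∈ F → y.1 ∈ F → x = y := fun x y hx hy =>
    Subtype.ext (hred _ _ fun c => by
      rw [x.2, y.2]
      exact ⟨iff_of_true (hM.tjoin_mem hx c) (hM.tjoin_mem hy c),
        iff_of_true (hM.tjoin_mem hx c) (hM.tjoin_mem hy c)⟩)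
  obtain ⟨f, hf⟩ := hB.nonempty
  have ht : (toReg f).1 ∈ F := (hM.regPart_mem_iff f).2 hf
  generalize toReg f = t at ht
  have hmem : ∀ x : Reg A, x.1 ∈ F ↔ x = t :=
    fun x => ⟨fun hx => huniq x t hx ht, fun hx => hx ▸ ht⟩
  have htop : ∀ x : Reg A, x ≤ t := fun x => by
    have : t ⊔ x = t := (hmem _).1 (hM.kjoin_mem ht x.1)
    rw [← this]
    exact le_sup_right
  refine ⟨t, ⟨fun x y z => Subtype.ext (h.kmeet_kjoin x.1 y.1 z.1), htop, fun a b hab => ?_⟩, ?_⟩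
  · obtain ⟨c, hc⟩ := hF.exists_separating_of_ltK (a := a.1) (b := b.1)
      ⟨hab.le, fun e => hab.ne (Subtype.ext e)⟩
    -- For regular elements the two separation alternatives coincide.
    rw [a.2, b.2, or_self] at hc
    have key : ∀ x : Reg A, x.1 ⋎ c ∈ F ↔ x ⊔ toReg c = t := fun x => by
      rw [← hmem, ← hM.regPart_mem_iff, regPart_tjoin, regPart_of_neg_eq x.2]
      rfl
    exact ⟨toReg c, fun e => hc.1 ((key a).2 e), (key b).1 hc.2⟩
  · ext a
    rw [mem_bifilterGen_top_iff htop, ← hM.regPart_mem_iff]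
    exact (hmem (toReg a)).trans Subtype.ext_iff

/-- Elements with `a <ₖ b` differ in the coordinate `regPart a` or `regPart (∼a)`; disjunctivity
there supplies a regular `c`. -/
theorem IsDualDisjunctive.exists_separating [h : IsDistributiveBilattice A] {t : Reg A}
    (ht : IsDualDisjunctive (Reg A) t) {a b : A} (hab : LtK a b) :
    ∃ c : A, (a ⋎ c ∉ bifilterGen {t.1} ∧ b ⋎ c ∈ bifilterGen {t.1}) ∨
      (∼a ⋎ c ∉ bifilterGen {t.1} ∧ ∼b ⋎ c ∈ bifilterGen {t.1}) := by
  have key : ∀ x y : A, LeK x y → regPart x ≠ regPart y →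
      ∃ c : A, x ⋎ c ∉ bifilterGen {t.1} ∧ y ⋎ c ∈ bifilterGen {t.1} := by
    intro x y hxy hne
    have hlt : toReg x < toReg y :=
      lt_of_le_of_ne hxy.regPart fun e => hne (congrArg Subtype.val e)
    obtain ⟨c, hc₁, hc₂⟩ := ht.disjunctive _ _ hlt
    refine ⟨c.1, ?_, ?_⟩
    · rw [mem_bifilterGen_top_iff ht.isTop, regPart_tjoin, regPart_of_neg_eq c.2]
      exact fun e => hc₁ (Subtype.ext e)
    · rw [mem_bifilterGen_top_iff ht.isTop, regPart_tjoin, regPart_of_neg_eq c.2]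
      exact congrArg Subtype.val hc₂
  by_cases h₁ : regPart a = regPart b
  · have h₂ : regPart (∼a) ≠ regPart (∼b) := fun h₂ => hab.2 (eq_of_regPart_eq h₁ h₂)
    obtain ⟨c, hc⟩ := key _ _ (h.neg_monotone_knowledge a b hab.1) h₂
    exact ⟨c, Or.inr hc⟩
  · obtain ⟨c, hc⟩ := key _ _ hab.1 h₁
    exact ⟨c, Or.inl hc⟩

theorem isReducedModelLB_tfae [Nontrivial A] (F : Set A) :
    List.TFAE [
      IsReducedModelLB F,
      IsDistributiveBilattice A ∧ IsBifilter F ∧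
        ∀ a b : A, LtT a b → ∃ c : A,
          (a ⋎ c ∉ F ∧ b ⋎ c ∈ F) ∨ (∼a ⋎ c ∈ F ∧ ∼b ⋎ c ∉ F),
      IsDistributiveBilattice A ∧ IsBifilter F ∧
        ∀ a b : A, LtK a b → ∃ c : A,
          (a ⋎ c ∉ F ∧ b ⋎ c ∈ F) ∨ (∼a ⋎ c ∉ F ∧ ∼b ⋎ c ∈ F),
      ∃ _ : IsDistributiveBilattice A,
        Isomorphic A (ProductBilattice (Reg A)) ∧
        ∃ t : Reg A, IsDualDisjunctive (Reg A) t ∧ F = bifilterGen {t.1}] := by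
  tfae_have 1 → 2 := fun hF =>
    ⟨hF.isDistributiveBilattice, hF.isBifilter, fun _ _ => hF.exists_separating_of_ltT⟩
  tfae_have 2 → 1 := fun ⟨_, hB, hsep⟩ => isReducedModelLB_of_separating_ltT hB hsep
  tfae_have 3 → 1 := fun ⟨_, hB, hsep⟩ => isReducedModelLB_of_separating_ltK hB hsep
  tfae_have 1 → 4 := fun hF =>
    have := hF.isDistributiveBilattice
    ⟨this, isomorphic_productBilattice_reg, hF.exists_isDualDisjunctive hF.isBifilter⟩
  tfae_have 4 → 3 := by
    rintro ⟨hA, -, t, ht, rfl⟩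
    exact ⟨hA, isBifilter_bifilterGen (Set.singleton_nonempty _),
      fun _ _ hab => ht.exists_separating hab⟩
  tfae_finish

end Characterization

/-! Products, subalgebras, and quasi-identities. -/

theorem isHom_proj {ι : Type v} (B : ι → Type u) [∀ i, BilatAlgebra (B i)] (i : ι) :
    IsHom fun x : ∀ i, B i => x i :=
  ⟨fun _ _ => rfl, fun _ _ => rfl, fun _ _ => rfl, fun _ _ => rfl, fun _ => rfl⟩

/-- On a one-element algebra the empty set is also reduced; products need a base point in every
filter, so the full set is taken instead. -/
theorem AlgStarLB.exists_nonempty {A : Type u} [BilatAlgebra A] (hA : AlgStarLB A) :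
    ∃ F : Set A, F.Nonempty ∧ IsReducedModelLB F := by
  obtain ⟨hne, F, hF⟩ := hA
  rcases subsingleton_or_nontrivial A with _ | _
  · exact ⟨Set.univ, Set.univ_nonempty, isReducedModelLB_iff.2
      ⟨fun _ _ _ _ _ _ => Set.mem_univ _, fun _ _ _ => Subsingleton.elim _ _⟩⟩
  · exact ⟨F, hF.nonempty, hF⟩

open Classical in
/-- The algebraic reducts of reduced models of `LB` are closed under direct products. -/
theorem AlgStarLB.pi {ι : Type v} {B : ι → Type u} [∀ i, BilatAlgebra (B i)]
    (hB : ∀ i, AlgStarLB (B i)) : AlgStarLB (∀ i, B i) := by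
  choose F hne hF using fun i => (hB i).exists_nonempty
  choose f hf using hne
  have hM : ∀ i, IsModelLB (F i) := fun i => (hF i).1
  refine ⟨⟨f⟩, {x | ∀ i, x i ∈ F i}, isReducedModelLB_iff.2 ⟨?_, fun x y hxy => ?_⟩⟩
  · intro Γ φ hφ g hg hΓ i
    exact hM i Γ φ hφ _ ((isHom_proj B i).comp hg) fun γ hγ => hΓ γ hγ i
  · have key : ∀ (z : ∀ i, B i) (i : ι) (c : B i),
        z ⋎ Function.update f i c ∈ {x | ∀ i, x i ∈ F i} ↔ z i ⋎ c ∈ F i := by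
      refine fun z i c => ⟨fun hz => by simpa [BilatAlgebra.tjoin] using hz i, fun hz j => ?_⟩
      change z j ⋎ Function.update f i c j ∈ F j
      by_cases hij : j = i
      · subst hij
        simpa using hz
      · rw [Function.update_of_ne hij, (hM j).tjoin_comm_mem_iff]
        exact (hM j).tjoin_mem (hf j) _
    funext i
    refine (isReducedModelLB_iff.1 (hF i)).2 _ _ fun c => ?_
    have := hxy (Function.update f i c)
    rwa [key, key, key, key] at this

/-! ### Failure of closure under subalgebras. -/

theorem isReducedModelLB_Tr : IsReducedModelLB Tr := by
  refine isReducedModelLB_iff.2 ⟨fun _ _ hφ => hφ, fun a b hab => ?_⟩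
  -- Joining with `⊥` leaves first coordinates unchanged, so this one context reads off both
  -- coordinates.
  have := hab ⟨false, false⟩
  simp only [mem_Tr, Four.tjoin_fst, Four.neg_fst, Bool.or_false] at this
  exact ProductBilattice.ext (Bool.coe_iff_coe.1 this.1) (Bool.coe_iff_coe.1 this.2)

theorem algStarLB_four : AlgStarLB Four := ⟨⟨⟨true, true⟩⟩, Tr, isReducedModelLB_Tr⟩

theorem BilatSubalgebra.isHom_val {A : Type u} [BilatAlgebra A] (S : BilatSubalgebra A) :
    IsHom fun x : S.carrier => x.1 :=
  ⟨fun _ _ => rfl, fun _ _ => rfl, fun _ _ => rfl, fun _ _ => rfl, fun _ => rfl⟩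

/-- A quasivariety is closed under subalgebras. -/
theorem IsQuasivariety.subalgebra {K : ∀ (A : Type u) [BilatAlgebra A], Prop}
    (hK : IsQuasivariety K) {A : Type u} [BilatAlgebra A] (S : BilatSubalgebra A) (hA : K A) :
    K S.carrier := by
  obtain ⟨Q, hQ⟩ := hK
  refine (hQ _).2 ⟨S.nonempty.to_subtype, fun q hq g hg hprem => Subtype.ext ?_⟩
  exact ((hQ A).1 hA).2 q hq _ (S.isHom_val.comp hg) fun e he => congrArg Subtype.val (hprem e he)

/-- The knowledge order of `FOUR`, as a subalgebra of the square of `FOUR`. It is the product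
bilattice of a three-element chain. -/
def knowledgePairs : BilatSubalgebra (ULift.{u} Bool → Four) where
  carrier := {x | LeK (x ⟨false⟩) (x ⟨true⟩)}
  nonempty := ⟨fun _ => ⟨true, true⟩, rfl⟩
  tmeet_mem a ha b hb := by
    rw [Set.mem_ofPred_eq, LeK] at ha
    rw [Set.mem_ofPred_eq, LeK] at hb
    change (a ⟨false⟩ ⋏ b ⟨false⟩) ⊗ₖ (a ⟨true⟩ ⋏ b ⟨true⟩) = a ⟨false⟩ ⋏ b ⟨false⟩
    grind
  tjoin_mem a ha b hb := by
    rw [Set.mem_ofPred_eq, LeK] at ha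
    rw [Set.mem_ofPred_eq, LeK] at hb
    change (a ⟨false⟩ ⋎ b ⟨false⟩) ⊗ₖ (a ⟨true⟩ ⋎ b ⟨true⟩) = a ⟨false⟩ ⋎ b ⟨false⟩
    grind
  kmeet_mem a ha b hb := by
    rw [Set.mem_ofPred_eq, LeK] at ha
    rw [Set.mem_ofPred_eq, LeK] at hb
    change (a ⟨false⟩ ⊗ₖ b ⟨false⟩) ⊗ₖ (a ⟨true⟩ ⊗ₖ b ⟨true⟩) = a ⟨false⟩ ⊗ₖ b ⟨false⟩
    grind
  kjoin_mem a ha b hb := by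
    rw [Set.mem_ofPred_eq, LeK] at ha
    rw [Set.mem_ofPred_eq, LeK] at hb
    change (a ⟨false⟩ ⊕ₖ b ⟨false⟩) ⊗ₖ (a ⟨true⟩ ⊕ₖ b ⟨true⟩) = a ⟨false⟩ ⊕ₖ b ⟨false⟩
    grind
  neg_mem a ha := by
    rw [Set.mem_ofPred_eq, LeK] at ha
    change ∼(a ⟨false⟩) ⊗ₖ ∼(a ⟨true⟩) = ∼(a ⟨false⟩)
    grind

/-- In the chain `bot < mid < top` of regular elements, only `top` joins with `mid` to `top`, and it
does so with `bot` too; so no `c` separates `bot` from `mid`. -/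
theorem not_algStarLB_knowledgePairs : ¬ AlgStarLB knowledgePairs.{u}.carrier := by
  rintro ⟨-, F, hF⟩
  let bot : knowledgePairs.{u}.carrier := ⟨fun _ => ⟨false, false⟩, rfl⟩
  let mid : knowledgePairs.{u}.carrier := ⟨fun i => ⟨i.down, i.down⟩, rfl⟩
  let top : knowledgePairs.{u}.carrier := ⟨fun _ => ⟨true, true⟩, rfl⟩
  have hne : bot ≠ mid := fun e =>
    Bool.false_ne_true (congrArg (fun x => (x.1 ⟨true⟩).fst) e)
  have : Nontrivial knowledgePairs.{u}.carrier := ⟨bot, mid, hne⟩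
  obtain ⟨_, -, t, ht, -⟩ := ((isReducedModelLB_tfae F).out 0 3).1 hF
  have hlt : (⟨bot, rfl⟩ : Reg knowledgePairs.{u}.carrier) < ⟨mid, rfl⟩ :=
    lt_of_le_of_ne rfl fun e => hne (congrArg Subtype.val e)
  obtain ⟨c, hc₁, hc₂⟩ := ht.disjunctive _ _ hlt
  have htop : t = ⟨top, rfl⟩ := by
    refine le_antisymm ?_ (ht.isTop _)
    exact Subtype.ext (funext fun i => by
      change t.1.1 i ⊗ₖ ⟨true, true⟩ = t.1.1 i
      grind)
  subst htop
  -- At index `false` the element `mid` is `⊥`, so `c` is `⊤` there, and by the knowledge order also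
  -- at index `true`.
  have h₁ : (⟨false, false⟩ : Four) ⊕ₖ c.1.1 ⟨false⟩ = ⟨true, true⟩ :=
    congrArg (fun x => x.1.1 ⟨false⟩) hc₂
  have h₂ : c.1.1 ⟨false⟩ ⊗ₖ c.1.1 ⟨true⟩ = c.1.1 ⟨false⟩ := c.1.2
  refine hc₁ (Subtype.ext (Subtype.ext (funext fun i => ?_)))
  change (⟨false, false⟩ : Four) ⊕ₖ c.1.1 i = ⟨true, true⟩
  rcases i with ⟨_ | _⟩
  · exact h₁
  · generalize c.1.1 ⟨false⟩ = p, c.1.1 ⟨true⟩ = q at h₁ h₂ ⊢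
    have h₃ := congrArg ProductBilattice.fst h₁
    have h₄ := congrArg ProductBilattice.snd h₁
    rw [← h₂] at h₃ h₄
    clear * - h₃ h₄
    ext <;> grind

/-- Indexing the square by `ULift Bool` places it in any given universe. -/
theorem exists_subalgebra_not_algStarLB :
    ∃ (B : Type u) (_ : BilatAlgebra B) (S : BilatSubalgebra B),
      AlgStarLB B ∧ ¬ AlgStarLB S.carrier :=
  ⟨_, _, knowledgePairs, AlgStarLB.pi fun _ => algStarLB_four, not_algStarLB_knowledgePairs⟩

theorem theoremt :
    (∀ (A : Type u) [BilatAlgebra A] [Nontrivial A] (F : Set A),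
      List.TFAE [
        IsReducedModelLB F,
        IsDistributiveBilattice A ∧ IsBifilter F ∧
          ∀ a b : A, LtT a b → ∃ c : A,
            (a ⋎ c ∉ F ∧ b ⋎ c ∈ F) ∨ (∼a ⋎ c ∈ F ∧ ∼b ⋎ c ∉ F),
        IsDistributiveBilattice A ∧ IsBifilter F ∧
          ∀ a b : A, LtK a b → ∃ c : A,
            (a ⋎ c ∉ F ∧ b ⋎ c ∈ F) ∨ (∼a ⋎ c ∉ F ∧ ∼b ⋎ c ∈ F),
        ∃ _ : IsDistributiveBilattice A,
          Isomorphic A (ProductBilattice (Reg A)) ∧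
          ∃ t : Reg A, IsDualDisjunctive (Reg A) t ∧ F = bifilterGen {t.1}]) ∧
    (∀ (ι : Type v) (B : ι → Type u) [∀ i, BilatAlgebra (B i)],
      (∀ i, AlgStarLB (B i)) → AlgStarLB (∀ i, B i)) ∧
    (∃ (B : Type u) (_ : BilatAlgebra B) (S : BilatSubalgebra B),
      AlgStarLB B ∧ ¬ AlgStarLB S.carrier) ∧
    ¬ IsQuasivariety (fun (A : Type u) [BilatAlgebra A] => AlgStarLB A) := by
  refine ⟨fun A _ _ F => isReducedModelLB_tfae F, fun ι B _ hB => AlgStarLB.pi hB,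
    exists_subalgebra_not_algStarLB, fun hK => ?_⟩
  obtain ⟨B, _, S, hB, hS⟩ := exists_subalgebra_not_algStarLB.{u}
  exact hS (hK.subalgebra S hB)
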